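/- Let $d\ge 1$ and write $\hat h(\omega)=\int_{\mathbb R^d}e^{-i\omega\cdot y}h(y)\,dy$ (extended to $L^2(\mathbb R^d)$ by Plancherel) and $v(\omega)=\prod_{i=1}^d(1+\omega_i^2)^{1/2}$. All functions are complex-valued. Say that $h\in L^2(\mathbb R^d)$ satisfies condition (R) if at least one of the following holds: (i) $h$ belongs to the Wiener space $X^{\infty,1}$, that is, $\int_{\mathbb R^d}\operatorname{ess\,sup}_{|y|<1}|h(x+y)|\,dx<\infty$; (ii) there are $\alpha>1/2$ and $B'>0$ such that $\sum_{k\in\mathbb Z^d}|(v^\alpha\hat h)(\omega-2\pi k)|^2\le B'$ for a.e. $\omega\in[0,2\pi]^d$. Let $\phi\in L^2(\mathbb R^d)$ satisfy the following three assumptions. 1. There are $A,B>0$ such that $A\le\sum_{k\in\mathbb Z^d}|\hat\phi(\omega-2\pi k)|^2\le B$ for a.e. $\omega\in\mathbb R^d$. 2. $\phi$ satisfies condition (R). 3. For every $j=1,\dots,d$ the distributional derivative $\partial_j\phi$ satisfies condition (R) (either alternative forces $\partial_j\phi\in L^2(\mathbb R^d)$). For $s>0$ let $U_s$ be the closed linear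 span in $L^2(\mathbb R^d)$ of the functions $\phi_{s,n}(x)=s^{-d/2}\phi((x-ns)/s)$, $n\in\mathbb Z^d$. For a measurable field $\tau:\mathbb R^d\to\mathbb R^d$ in $L^\infty(\mathbb R^d;\mathbb R^d)$ put $\|\tau\|_{L^\infty}=\operatorname{ess\,sup}_y|\tau(y)|$, with the Euclidean norm $|\cdot|$, and $F_\tau f(x)=f(x-\tau(x))$. Then every $f\in U_s$ has a (unique) continuous representative, with which $F_\tau f$ is defined, and $F_\tau f\in L^2(\mathbb R^d)$ for every $\tau\in L^\infty(\mathbb R^d;\mathbb R^d)$. Moreover there is a constant $C>0$ such that for every $\tau\in L^\infty(\mathbb R^d;\mathbb R^d)$, $s>0$ and $f\in U_s$, $$\|F_\tau f-f\|_{L^2}\le\begin{cases}C\,(\|\tau\|_{L^\infty}/s)\,\|f\|_{L^2}&(\|\tau\|_{L^\infty}/s\le1),\\ C\,(\|\tau\|_{L^\infty}/s)^{d/2}\,\|f\|_{L^2}&(\|\tau\|_{L^\infty}/s\ge1),\end{cases}$$ and for every Banach space $Y$ and every Lipschitz map $\Phi:L^2(\mathbb R^d)\to Y$ with best Lipschitz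 constant $\mathrm{Lip}(\Phi)$, $$\|\Phi(F_\tau f)-\Phi(f)\|_Y\le\begin{cases}C\,\mathrm{Lip}(\Phi)\,(\|\tau\|_{L^\infty}/s)\,\|f\|_{L^2}&(\|\tau\|_{L^\infty}/s\le1),\\ C\,\mathrm{Lip}(\Phi)\,(\|\tau\|_{L^\infty}/s)^{d/2}\,\|f\|_{L^2}&(\|\tau\|_{L^\infty}/s\ge1).\end{cases}$$ -/

import Mathlib

open MeasureTheory
open scoped ENNReal NNReal FourierTransform

noncomputable section

/-- `ℝ^d` with the Euclidean norm. -/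
abbrev Rd (d : ℕ) : Type := EuclideanSpace ℝ (Fin d)

/-- The complex Hilbert space `L²(ℝ^d)`. -/
abbrev L2 (d : ℕ) : Type := Lp ℂ 2 (volume : Measure (Rd d))

/-- The point of `ℝ^d` with integer coordinates `k`. -/
def latticePoint {d : ℕ} (k : Fin d → ℤ) : Rd d :=
  WithLp.toLp 2 (fun i => (k i : ℝ))

/-- The function `φ_{s,n}(x) = s^{-d/2} φ((x - n s) / s)`. -/
def atomFun {d : ℕ} (φ : Rd d → ℂ) (s : ℝ) (n : Fin d → ℤ) (x : Rd d) : ℂ :=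
  ((s ^ (-(d : ℝ) / 2) : ℝ) : ℂ) * φ (s⁻¹ • (x - s • latticePoint n))

/-- The functions `φ_{s,n}` are in `L²(ℝ^d)`, so that each of them has exactly one class
in the generating set of `approxSpace` below. -/
theorem memLp_atomFun {d : ℕ} (φ : L2 d) {s : ℝ} (hs : 0 < s) (n : Fin d → ℤ) :
    MemLp (atomFun φ s n) 2 (volume : Measure (Rd d)) := by
  have hφ : MemLp (φ : Rd d → ℂ) 2 volume := Lp.memLp φ
  have hne : s⁻¹ ≠ 0 := (inv_pos.mpr hs).ne'
  have h1 : MemLp (fun y : Rd d => φ (s⁻¹ • y)) 2 volume := by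
    have hmap := Measure.map_addHaar_smul (volume : Measure (Rd d)) hne
    have h2 : MemLp (φ : Rd d → ℂ) 2
        (Measure.map (fun y : Rd d => s⁻¹ • y) (volume : Measure (Rd d))) := by
      change MemLp (φ : Rd d → ℂ) 2 (Measure.map (s⁻¹ • ·) (volume : Measure (Rd d)))
      rw [hmap]
      exact hφ.smul_measure ENNReal.ofReal_ne_top
    exact h2.comp_of_map (by fun_prop)
  have h3 : MemLp (fun x : Rd d => φ (s⁻¹ • (x - s • latticePoint n))) 2 volume :=
    h1.comp_measurePreserving (measurePreserving_sub_right volume (s • latticePoint n))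
  exact h3.const_mul _

/-- The approximation space `U_s`, the closed linear span in `L²(ℝ^d)` of the
`φ_{s,n}`, `n ∈ ℤ^d`. -/
def approxSpace {d : ℕ} (φ : L2 d) (s : ℝ) : Submodule ℂ (L2 d) :=
  (Submodule.span ℂ
    {g : L2 d | ∃ n : Fin d → ℤ, (g : Rd d → ℂ) =ᵐ[volume] atomFun φ s n}).topologicalClosure

/-- The Fourier transform on `L²(ℝ^d)` with the normalization
`φ̂(ω) = ∫ e^{-i ω·y} φ(y) dy`. The one of Mathlib, denoted by `𝓕`, has the kernel
`e^{-2π i ω·y}`, hence the dilation by `(2π)⁻¹`. -/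
def fourierL2 {d : ℕ} (φ : L2 d) (ω : Rd d) : ℂ :=
  (𝓕 φ : L2 d) ((2 * Real.pi)⁻¹ • ω)

/-- The weight `v(ω) = ⟨ω_1⟩ ⋯ ⟨ω_d⟩`, with `⟨t⟩ = (1 + t²)^{1/2}`. -/
def weight {d : ℕ} (ω : Rd d) : ℝ :=
  ∏ i, Real.sqrt (1 + (ω i) ^ 2)

/-- The Riesz basis condition: `A ≤ ∑_k |φ̂(ω - 2πk)|² ≤ B` for a.e. `ω`. -/
def RieszCondition {d : ℕ} (φ : L2 d) : Prop :=
  ∃ A B : ℝ, 0 < A ∧ 0 < B ∧ ∀ᵐ ω : Rd d,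
    ENNReal.ofReal A ≤
        ∑' k : Fin d → ℤ, ‖fourierL2 φ (ω - (2 * Real.pi) • latticePoint k)‖ₑ ^ 2 ∧
      ∑' k : Fin d → ℤ, ‖fourierL2 φ (ω - (2 * Real.pi) • latticePoint k)‖ₑ ^ 2 ≤
        ENNReal.ofReal B

/-- The norm of the Wiener space `X^{∞,1}`: `∫ ‖φ(x + ·)‖_{L^∞(B_1)} dx`. -/
def wienerNorm {d : ℕ} (φ : Rd d → ℂ) : ℝ≥0∞ :=
  ∫⁻ x : Rd d, eLpNorm (fun y => φ (x + y)) ∞ (volume.restrict (Metric.ball (0 : Rd d) 1))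

/-- `φ` belongs to the Wiener space `X^{∞,1}`. -/
def WienerCondition {d : ℕ} (φ : L2 d) : Prop :=
  wienerNorm (φ : Rd d → ℂ) < ∞

/-- The Sobolev type condition: for some `α > 1/2` and `B' > 0`,
`∑_k |(v^α φ̂)(ω - 2πk)|² ≤ B'` for a.e. `ω ∈ [0, 2π]^d`. -/
def SobolevCondition {d : ℕ} (φ : L2 d) : Prop :=
  ∃ α B' : ℝ, 1 / 2 < α ∧ 0 < B' ∧ ∀ᵐ ω : Rd d,
    (∀ i, ω i ∈ Set.Icc 0 (2 * Real.pi)) →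
      ∑' k : Fin d → ℤ,
          ‖((weight (ω - (2 * Real.pi) • latticePoint k) ^ α : ℝ) : ℂ) *
            fourierL2 φ (ω - (2 * Real.pi) • latticePoint k)‖ₑ ^ 2 ≤
        ENNReal.ofReal B'

/-- At least one of the two regularity and decay conditions holds. -/
def RegularityCondition {d : ℕ} (φ : L2 d) : Prop :=
  WienerCondition φ ∨ SobolevCondition φ

/-- `ψ` is the partial derivative `∂_j φ` in the sense of distributions. -/
def IsWeakPartialDeriv {d : ℕ} (j : Fin d) (φ ψ : L2 d) : Prop :=
  ∀ η : Rd d → ℂ, ContDiff ℝ (⊤ : ℕ∞) η → HasCompactSupport η →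
    ∫ x, φ x * fderiv ℝ η x (EuclideanSpace.single j 1) = -∫ x, ψ x * η x

/-- Every distributional derivative `∂_j φ` satisfies at least one of the two conditions.
Either of them forces `∂_j φ ∈ L²(ℝ^d)`, because the Wiener space `X^{∞,1}` is contained in
`L²(ℝ^d)`, and because integrating the Sobolev type condition over `[0, 2π]^d` shows that the
Fourier transform of `∂_j φ` is square integrable; so it is no restriction to
take `∂_j φ` in `L²(ℝ^d)`. -/
def DerivRegularityCondition {d : ℕ} (φ : L2 d) : Prop :=
  ∀ j : Fin d, ∃ ψ : L2 d, IsWeakPartialDeriv j φ ψ ∧ RegularityCondition ψ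

/-- The deformation `F_τ g(x) = g(x - τ(x))`. -/
def deform {d : ℕ} (τ : Rd d → Rd d) (g : Rd d → ℂ) (x : Rd d) : ℂ :=
  g (x - τ x)

/-- The norm `‖τ‖_{L^∞} = ess sup |τ|`. -/
def supNorm {d : ℕ} (τ : Rd d → Rd d) : ℝ :=
  (eLpNorm τ ∞ volume).toReal

/-- The best Lipschitz constant `Lip(Φ)` of a Lipschitz map. -/
def lipConst {X Y : Type*} [PseudoEMetricSpace X] [PseudoEMetricSpace Y] (Φ : X → Y) : ℝ≥0 :=
  sInf {K : ℝ≥0 | LipschitzWith K Φ}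

end

/-!
The deformation estimate is a local statement about suprema, and it is reduced to the control of a
function `f ∈ U_s` and of its gradient in the amalgam space `W(L^∞, ℓ²)`, whose squared norm
`amalgamNormSq` is the sum over the lattice of the squared essential suprema over the windows around
the lattice points.

At scale `1`, let `f = ∑ a_n φ(· - n)` be a finite sum. The Fourier transform of `f` is the
trigonometric polynomial with coefficients `a` times `φ̂`, so that periodization and Parseval's
identity turn the lower Riesz bound into `∑ |a_n|² ≤ C ‖f‖²`
(`RieszCondition.exists_coeffNormSq_le`). What remains is that for each `h` with the regularity
condition, thus for `φ` and for its weak derivatives, the map `a ↦ ∑ a_n h(· - n)` is bounded from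
`ℓ²` to `W(L^∞, ℓ²)` (`RegularityCondition.exists_amalgamNormSq_le`).

* Under the Wiener condition, the essential suprema of `h` over the windows are summable, and
  Young's inequality `ℓ² * ℓ¹ ⊆ ℓ²` applies.
* Under the Sobolev type condition, periodization and Parseval's identity give
  `‖v^α ĥ_a‖ ≤ C ‖a‖` for `h_a = ∑ a_n h(· - n)`. Hence it suffices to bound the samples of a
  function `F` at points `x_k` close to the lattice points `k` by `∑ |F(x_k)|² ≤ C ‖v^α F̂‖²`. By
  duality this is an upper bound for the Gram matrix of the functions `v^{-α} e^{2π i x_k·ξ}`. Its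
  entries are the values at `x_k - x_l` of the Fourier transform of `v^{-2α}`, a tensor product of
  functions which decay quadratically, because `(1 + t²)^{-α}` and its first two derivatives are
  integrable if `α > 1/2`. Schur's test concludes (`exists_sum_sampling_le`).

In particular the weak derivatives of `φ` are bounded, and `φ` has a continuous representative. By
mollification, the sums `f` are Lipschitz on each window, with a constant given by the essential
suprema of their weak derivatives there (`norm_sub_le_of_weakPartialDeriv_le`). For displacements of
size `r ≤ 1` the difference `F_τ f - f` is at most `r` times these constants, which are square
summable over the windows (`lintegral_deform_sub_sq_le`). For `r ≥ 1` a displaced point lies in one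
of the `O(r^d)` cells around the original one, which costs a factor `r^d` in the squared norm
(`lintegral_deform_sub_sq_le_of_one_le`). A dilation gives the same bounds at each scale `s`, for
`r = ‖τ‖ / s`, and they extend to the closed span by uniform convergence of the continuous
representatives and Fatou's lemma. The bound for a Lipschitz map `Φ` is an immediate consequence.
-/

/-! ### The integer cells of `ℝ^d` -/

/-- The half-open unit cube `∏ i, (k_i, k_i + 1]`. These cubes partition `ℝ^d`; being closed on
the right, they match the fundamental domains that Mathlib uses for the torus. -/
def cell {d : ℕ} (k : Fin d → ℤ) : Set (Rd d) :=
  {x | ∀ i, x i ∈ Set.Ioc (k i : ℝ) (k i + 1)}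

theorem latticePoint_apply {d : ℕ} (k : Fin d → ℤ) (i : Fin d) :
    latticePoint k i = (k i : ℝ) := rfl

theorem latticePoint_sub {d : ℕ} (k n : Fin d → ℤ) :
    latticePoint (k - n) = latticePoint k - latticePoint n := by
  ext i; simp [latticePoint_apply]

theorem measurableSet_cell {d : ℕ} (k : Fin d → ℤ) : MeasurableSet (cell k) := by
  have : cell k = ⋂ i, (fun x : Rd d => x i) ⁻¹' Set.Ioc (k i : ℝ) (k i + 1) := by
    ext x; simp [cell]
  rw [this]
  exact MeasurableSet.iInter fun i => measurableSet_Ioc.preimage (by fun_prop)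

theorem mem_cell_iff {d : ℕ} {k : Fin d → ℤ} {x : Rd d} :
    x ∈ cell k ↔ k = fun i => ⌈x i⌉ - 1 := by
  constructor
  · intro h
    ext i
    have := (Int.ceil_eq_iff (a := x i) (z := k i + 1)).2
      ⟨by push_cast; linarith [(h i).1], by push_cast; exact (h i).2⟩
    omega
  · rintro rfl i
    constructor
    · push_cast; linarith [Int.ceil_lt_add_one (x i)]
    · push_cast; linarith [Int.le_ceil (x i)]

theorem pairwise_disjoint_cell {d : ℕ} :
    Pairwise (Function.onFun Disjoint (cell : (Fin d → ℤ) → Set (Rd d))) := by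
  intro k l hkl
  rw [Function.onFun, Set.disjoint_left]
  intro x hk hl
  exact hkl ((mem_cell_iff.1 hk).trans (mem_cell_iff.1 hl).symm)

theorem iUnion_cell {d : ℕ} : ⋃ k : Fin d → ℤ, cell k = (Set.univ : Set (Rd d)) :=
  Set.eq_univ_of_forall fun _ => Set.mem_iUnion.2 ⟨_, mem_cell_iff.2 rfl⟩

theorem lintegral_eq_tsum_cell {d : ℕ} (g : Rd d → ℝ≥0∞) :
    ∫⁻ x, g x = ∑' k : Fin d → ℤ, ∫⁻ x in cell k, g x := by
  rw [← lintegral_iUnion measurableSet_cell pairwise_disjoint_cell, iUnion_cell,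
    setLIntegral_univ]

theorem setLIntegral_cell {d : ℕ} (k : Fin d → ℤ) (g : Rd d → ℝ≥0∞) :
    ∫⁻ x in cell k, g x = ∫⁻ x in cell (0 : Fin d → ℤ), g (x + latticePoint k) := by
  have h := (measurePreserving_add_right (volume : Measure (Rd d))
    (latticePoint k)).setLIntegral_comp_preimage_emb
      (MeasurableEquiv.addRight (latticePoint k)).measurableEmbedding g (cell k)
  rw [← h]
  congr 2
  ext x
  simp only [cell, Set.mem_ofPred_eq, Set.mem_preimage, PiLp.add_apply, latticePoint_apply,
    Pi.zero_apply, Set.mem_Ioc]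
  refine forall_congr' fun i => ?_
  constructor <;> rintro ⟨h1, h2⟩ <;> constructor <;> push_cast at * <;> linarith

/-- Unfolding of an integral over `ℝ^d` to the unit cube. -/
theorem lintegral_eq_lintegral_cell_tsum {d : ℕ} {g : Rd d → ℝ≥0∞} (hg : AEMeasurable g) :
    ∫⁻ x, g x = ∫⁻ x in cell (0 : Fin d → ℤ), ∑' k : Fin d → ℤ, g (x - latticePoint k) := by
  rw [lintegral_eq_tsum_cell, ← (Equiv.neg (Fin d → ℤ)).tsum_eq, lintegral_tsum]
  · refine tsum_congr fun k => ?_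
    rw [setLIntegral_cell]
    refine lintegral_congr fun x => ?_
    congr 1
    ext i; simp [latticePoint_apply, sub_eq_add_neg]
  · intro k
    exact (hg.comp_quasiMeasurePreserving
      (measurePreserving_sub_right volume (latticePoint k)).quasiMeasurePreserving).restrict

section Torus

-- The Haar probability measure on the circle, which the Fourier theory of `UnitAddTorus` uses.
attribute [local instance] instMeasureSpaceUnitAddCircle

theorem isProbabilityMeasure_unitAddCircle :
    IsProbabilityMeasure (volume : Measure UnitAddCircle) :=
  inferInstanceAs (IsProbabilityMeasure AddCircle.haarAddCircle)

attribute [local instance] isProbabilityMeasure_unitAddCircle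

theorem lintegral_cell_zero {d : ℕ} {g : (Fin d → ℝ) → ℝ≥0∞} :
    ∫⁻ x in cell (0 : Fin d → ℤ), g x.ofLp =
      ∫⁻ x in {x : Fin d → ℝ | ∀ i, x i ∈ Set.Ioc ((0 : Fin d → ℝ) i) ((0 : Fin d → ℝ) i + 1)},
        g x := by
  have h := (EuclideanSpace.volume_preserving_symm_measurableEquiv_toLp
    (Fin d)).setLIntegral_comp_preimage_emb (MeasurableEquiv.measurableEmbedding _) g
      {x : Fin d → ℝ | ∀ i, x i ∈ Set.Ioc ((0 : Fin d → ℝ) i) ((0 : Fin d → ℝ) i + 1)}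
  rw [← h]
  congr 2
  ext x
  simp [cell]

theorem volume_cell {d : ℕ} (k : Fin d → ℤ) : volume (cell k) = 1 := by
  have h1 : ∫⁻ x in cell k, (1 : ℝ≥0∞) = 1 := by
    rw [setLIntegral_cell k (fun _ => 1)]
    have := lintegral_cell_zero (d := d) (g := fun _ => 1)
    rw [this, ← UnitAddTorus.lintegral_preimage (fun _ => 1) 0]
    simp only [lintegral_const, one_mul]
    exact measure_univ (μ := (volume : Measure (UnitAddTorus (Fin d))))
  simpa using h1

/-! ### Trigonometric polynomials -/

/-- The trigonometric polynomial `∑ n, a_n e^{-2π i n·ξ}`, the factor by which the Fourier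
transform turns `h` into the transform of `∑ n, a_n h(· - n)`. -/
noncomputable def trigPoly {d : ℕ} (a : (Fin d → ℤ) →₀ ℂ) (ξ : Rd d) : ℂ :=
  ∑ n ∈ a.support, a n * ((𝐞 (-(inner ℝ (latticePoint n) ξ)) : Circle) : ℂ)

/-- The sum `∑ n, ‖a_n‖²`, with values in `[0, ∞]`. -/
noncomputable def coeffNormSq {d : ℕ} (a : (Fin d → ℤ) →₀ ℂ) : ℝ≥0∞ :=
  ∑ n ∈ a.support, ‖a n‖ₑ ^ 2

theorem inner_latticePoint {d : ℕ} (n : Fin d → ℤ) (ξ : Rd d) :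
    inner ℝ (latticePoint n) ξ = ∑ i, (n i : ℝ) * ξ i := by
  simp [PiLp.inner_apply, latticePoint_apply, mul_comm]

theorem continuous_trigPoly {d : ℕ} (a : (Fin d → ℤ) →₀ ℂ) : Continuous (trigPoly a) := by
  unfold trigPoly
  fun_prop

theorem fourierChar_latticePoint {d : ℕ} (n : Fin d → ℤ) (ξ : Rd d) :
    ((𝐞 (-(inner ℝ (latticePoint n) ξ)) : Circle) : ℂ) =
      UnitAddTorus.mFourier (-n) (fun i => (ξ i : UnitAddCircle)) := by
  rw [inner_latticePoint, Real.fourierChar_apply]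
  simp only [UnitAddTorus.mFourier, ContinuousMap.coe_mk, fourier_coe_apply, ← Complex.exp_sum]
  congr 1
  push_cast
  rw [← Finset.sum_neg_distrib, Finset.mul_sum, Finset.sum_mul]
  refine Finset.sum_congr rfl fun i _ => ?_
  simp
  ring

theorem trigPoly_sub_latticePoint {d : ℕ} (a : (Fin d → ℤ) →₀ ℂ) (ξ : Rd d) (k : Fin d → ℤ) :
    trigPoly a (ξ - latticePoint k) = trigPoly a ξ := by
  unfold trigPoly
  refine Finset.sum_congr rfl fun n _ => ?_
  rw [fourierChar_latticePoint, fourierChar_latticePoint]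
  congr 3
  ext i
  simp [latticePoint_apply]

/-- Parseval's identity for a trigonometric polynomial. -/
theorem lintegral_trigPoly {d : ℕ} (a : (Fin d → ℤ) →₀ ℂ) :
    ∫⁻ ξ in cell (0 : Fin d → ℤ), ‖trigPoly a ξ‖ₑ ^ 2 = coeffNormSq a := by
  let P : C(UnitAddTorus (Fin d), ℂ) := ∑ n ∈ a.support, a n • UnitAddTorus.mFourier (-n)
  have hP : ∀ ξ : Rd d, trigPoly a ξ = P (fun i => (ξ i : UnitAddCircle)) := by
    intro ξ
    simp only [trigPoly, P, fourierChar_latticePoint]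
    simp [ContinuousMap.coe_sum]
  simp_rw [hP]
  rw [lintegral_cell_zero (g := fun x => ‖P (fun i => (x i : UnitAddCircle))‖ₑ ^ 2),
    ← UnitAddTorus.lintegral_preimage (fun x => ‖P x‖ₑ ^ 2) 0]
  have h1 : eLpNorm P 2 (volume : Measure (UnitAddTorus (Fin d))) ^ 2 =
      ∫⁻ x, ‖P x‖ₑ ^ 2 := by
    have := eLpNorm_nnreal_pow_eq_lintegral (f := P)
      (μ := (volume : Measure (UnitAddTorus (Fin d)))) (p := 2) two_ne_zero
    simpa using this
  refine h1.symm.trans ?_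
  let Q : Lp ℂ 2 (volume : Measure (UnitAddTorus (Fin d))) := ContinuousMap.toLp 2 volume ℂ P
  have h2 : eLpNorm P 2 (volume : Measure (UnitAddTorus (Fin d))) = ‖Q‖ₑ := by
    rw [Lp.enorm_def]
    exact eLpNorm_congr_ae (ContinuousMap.coeFn_toLp volume P).symm
  have h3 : Q = ∑ n ∈ a.support, a n • UnitAddTorus.mFourierLp 2 (-n) := by
    simp only [Q, P, map_sum, map_smul]
  have h4 : ‖Q‖ ^ 2 = ∑ n ∈ a.support, ‖a n‖ ^ 2 := by
    have ho : Orthonormal ℂ (fun n : Fin d → ℤ => UnitAddTorus.mFourierLp (d := Fin d) 2 (-n)) :=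
      UnitAddTorus.orthonormal_mFourier.comp _ neg_injective
    have := ho.inner_sum a a a.support
    rw [← h3, inner_self_eq_norm_sq_to_K] at this
    simp only [Complex.conj_mul'] at this
    refine Complex.ofReal_injective ?_
    push_cast
    exact this
  rw [h2, coeffNormSq, ← ofReal_norm, ← ENNReal.ofReal_pow (norm_nonneg _), h4,
    ENNReal.ofReal_sum_of_nonneg (fun _ _ => by positivity)]
  refine Finset.sum_congr rfl fun n _ => ?_
  rw [← ofReal_norm, ENNReal.ofReal_pow (norm_nonneg _)]

end Torus

theorem lintegral_trigPoly_mul {d : ℕ} (a : (Fin d → ℤ) →₀ ℂ) {w : Rd d → ℝ≥0∞}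
    (hw : AEMeasurable w) :
    ∫⁻ ξ, ‖trigPoly a ξ‖ₑ ^ 2 * w ξ =
      ∫⁻ ξ in cell (0 : Fin d → ℤ),
        ‖trigPoly a ξ‖ₑ ^ 2 * ∑' k : Fin d → ℤ, w (ξ - latticePoint k) := by
  rw [lintegral_eq_lintegral_cell_tsum]
  · simp_rw [trigPoly_sub_latticePoint, ENNReal.tsum_mul_left]
  · exact ((continuous_trigPoly a).enorm.measurable.pow_const 2).aemeasurable.mul hw

/-- If the periodization of a weight `w` is at most `B`, multiplication by a trigonometric
polynomial is bounded from `ℓ²` to `L²(w)`. -/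
theorem lintegral_trigPoly_mul_le {d : ℕ} (a : (Fin d → ℤ) →₀ ℂ) {w : Rd d → ℝ≥0∞}
    (hw : AEMeasurable w) {B : ℝ≥0∞}
    (hB : ∀ᵐ ξ, ξ ∈ cell (0 : Fin d → ℤ) → ∑' k : Fin d → ℤ, w (ξ - latticePoint k) ≤ B) :
    ∫⁻ ξ, ‖trigPoly a ξ‖ₑ ^ 2 * w ξ ≤ B * coeffNormSq a := by
  rw [lintegral_trigPoly_mul a hw, ← lintegral_trigPoly, ← lintegral_const_mul _
    ((continuous_trigPoly a).enorm.measurable.pow_const 2)]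
  refine lintegral_mono_ae ?_
  rw [ae_restrict_iff' (measurableSet_cell 0)]
  filter_upwards [hB] with ξ h hξ
  rw [mul_comm]
  gcongr
  exact h hξ

/-- If the periodization of a weight `w` is at least `A`, multiplication by a trigonometric
polynomial is bounded below from `ℓ²` to `L²(w)`. -/
theorem le_lintegral_trigPoly_mul {d : ℕ} (a : (Fin d → ℤ) →₀ ℂ) {w : Rd d → ℝ≥0∞}
    (hw : AEMeasurable w) {A : ℝ≥0∞}
    (hA : ∀ᵐ ξ : Rd d, A ≤ ∑' k : Fin d → ℤ, w (ξ - latticePoint k)) :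
    A * coeffNormSq a ≤ ∫⁻ ξ, ‖trigPoly a ξ‖ₑ ^ 2 * w ξ := by
  rw [lintegral_trigPoly_mul a hw, ← lintegral_trigPoly, ← lintegral_const_mul _
    ((continuous_trigPoly a).enorm.measurable.pow_const 2)]
  refine lintegral_mono_ae (ae_restrict_of_ae ?_)
  filter_upwards [hA] with ξ h
  rw [mul_comm]
  gcongr

/-! ### Integer translates in `L²` and the Fourier transform -/

/-- Translation `f ↦ f(· - v)` as a linear isometry of `L²`. -/
noncomputable def translateL2 {d : ℕ} (v : Rd d) : L2 d →ₗᵢ[ℂ] L2 d :=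
  Lp.compMeasurePreservingₗᵢ ℂ (fun x : Rd d => x - v) (measurePreserving_sub_right volume v)

/-- The function `∑ n, a_n h(· - n)`. -/
noncomputable def latticeSum {d : ℕ} (a : (Fin d → ℤ) →₀ ℂ) (h : Rd d → ℂ) (x : Rd d) : ℂ :=
  ∑ n ∈ a.support, a n * h (x - latticePoint n)

/-- The class of `latticeSum a h` in `L²`. -/
noncomputable def latticeSumL2 {d : ℕ} (a : (Fin d → ℤ) →₀ ℂ) (h : L2 d) : L2 d :=
  ∑ n ∈ a.support, a n • translateL2 (latticePoint n) h

theorem coeFn_translateL2 {d : ℕ} (v : Rd d) (f : L2 d) :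
    translateL2 v f =ᵐ[volume] fun x => f (x - v) :=
  Lp.coeFn_compMeasurePreserving f _

theorem latticeSum_congr_ae {d : ℕ} (a : (Fin d → ℤ) →₀ ℂ) {h h' : Rd d → ℂ}
    (hh : h =ᵐ[volume] h') : latticeSum a h =ᵐ[volume] latticeSum a h' := by
  have h1 : ∀ n : Fin d → ℤ, ∀ᵐ x : Rd d, h (x - latticePoint n) = h' (x - latticePoint n) :=
    fun n => (measurePreserving_sub_right volume (latticePoint n)).quasiMeasurePreserving.ae hh
  filter_upwards [ae_all_iff.2 h1] with x hx
  exact Finset.sum_congr rfl fun n _ => by rw [hx n]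

theorem coeFn_latticeSumL2 {d : ℕ} (a : (Fin d → ℤ) →₀ ℂ) (h : L2 d) :
    latticeSumL2 a h =ᵐ[volume] latticeSum a h := by
  have h1 : ∀ n : Fin d → ℤ, ∀ᵐ x : Rd d,
      (a n • translateL2 (latticePoint n) h : L2 d) x = a n * h (x - latticePoint n) := by
    intro n
    filter_upwards [Lp.coeFn_smul (a n) (translateL2 (latticePoint n) h),
      coeFn_translateL2 (latticePoint n) h] with x h1 h2
    rw [h1, Pi.smul_apply, h2, smul_eq_mul]
  filter_upwards [ae_all_iff.2 h1, Lp.coeFn_finsetSum a.support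
    (fun n => a n • translateL2 (latticePoint n) h)] with x hx h2
  rw [latticeSumL2, h2, Finset.sum_apply]
  exact Finset.sum_congr rfl fun n _ => hx n

theorem norm_fourierChar {d : ℕ} (v ξ : Rd d) :
    ‖((𝐞 (-(inner ℝ v ξ)) : Circle) : ℂ)‖ = 1 :=
  Circle.norm_coe _

theorem memLp_fourierChar_mul {d : ℕ} (v : Rd d) (f : L2 d) :
    MemLp (fun ξ : Rd d => ((𝐞 (-(inner ℝ v ξ)) : Circle) : ℂ) * f ξ) 2 volume := by
  refine (Lp.memLp f).of_le ?_ ?_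
  · exact (Continuous.aestronglyMeasurable (by fun_prop)).mul (Lp.memLp f).1
  · exact Filter.Eventually.of_forall fun ξ => by
      rw [norm_mul, norm_fourierChar, one_mul]

/-- The Fourier transform turns translations into modulations. The case of Schwartz functions
is a change of variables; both sides are isometric in `f`. -/
theorem fourier_translateL2 {d : ℕ} (v : Rd d) (f : L2 d) :
    (𝓕 (translateL2 v f) : L2 d) =ᵐ[volume]
      fun ξ => ((𝐞 (-(inner ℝ v ξ)) : Circle) : ℂ) * (𝓕 f : L2 d) ξ := by
  let M : L2 d → L2 d := fun g => (memLp_fourierChar_mul v g).toLp _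
  have hM : Isometry M := by
    intro g g'
    rw [Lp.edist_toLp_toLp, Lp.edist_def]
    refine eLpNorm_congr_norm_ae (Filter.Eventually.of_forall fun ξ => ?_)
    simp only [Pi.sub_apply]
    rw [← mul_sub, norm_mul, norm_fourierChar, one_mul]
  suffices h : ∀ f : L2 d, (𝓕 (translateL2 v f) : L2 d) = M (𝓕 f) by
    rw [h f]
    exact MemLp.coeFn_toLp _
  intro f
  refine DenseRange.induction_on (p := fun f : L2 d => (𝓕 (translateL2 v f) : L2 d) = M (𝓕 f))
    (SchwartzMap.denseRange_toLpCLM (p := 2) ENNReal.ofNat_ne_top) f ?_ ?_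
  · refine isClosed_eq ?_ ?_
    · exact (Lp.fourierTransformₗᵢ (Rd d) ℂ).continuous.comp (translateL2 v).continuous
    · exact hM.continuous.comp (Lp.fourierTransformₗᵢ (Rd d) ℂ).continuous
  · intro g
    have h1 : translateL2 v (g.toLp 2) = (SchwartzMap.compSubConstCLM ℂ v g).toLp 2 := by
      refine Lp.ext ?_
      filter_upwards [coeFn_translateL2 v (g.toLp 2),
        (SchwartzMap.compSubConstCLM ℂ v g).coeFn_toLp 2 volume,
        (measurePreserving_sub_right volume v).quasiMeasurePreserving.ae (g.coeFn_toLp 2 volume)]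
        with x h1 h2 h3
      rw [h1, h2, h3]
      rfl
    rw [SchwartzMap.toLpCLM_apply, h1, SchwartzMap.toLp_fourier_eq, SchwartzMap.toLp_fourier_eq]
    refine Lp.ext ?_
    filter_upwards [(𝓕 (SchwartzMap.compSubConstCLM ℂ v g)).coeFn_toLp 2 volume,
      (𝓕 g).coeFn_toLp 2 volume,
      MemLp.coeFn_toLp (memLp_fourierChar_mul v ((𝓕 g).toLp 2))] with ξ h1 h2 h3
    rw [h1, h3, h2, SchwartzMap.fourier_coe, SchwartzMap.fourier_coe]
    have h4 := congrFun (VectorFourier.fourierIntegral_comp_add_right 𝐞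
      (volume : Measure (Rd d)) (innerₗ (Rd d)) g (-v)) ξ
    simp only [map_neg, LinearMap.neg_apply, innerₗ_apply_apply] at h4
    rw [Real.fourier_eq, Real.fourier_eq]
    simpa [VectorFourier.fourierIntegral, Function.comp_def, Circle.smul_def,
      ← sub_eq_add_neg] using h4

theorem fourier_latticeSumL2 {d : ℕ} (a : (Fin d → ℤ) →₀ ℂ) (h : L2 d) :
    (𝓕 (latticeSumL2 a h) : L2 d) =ᵐ[volume] fun ξ => trigPoly a ξ * (𝓕 h : L2 d) ξ := by
  have h0 : (𝓕 (latticeSumL2 a h) : L2 d) =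
      ∑ n ∈ a.support, a n • (𝓕 (translateL2 (latticePoint n) h) : L2 d) := by
    change Lp.fourierTransformₗᵢ (Rd d) ℂ (latticeSumL2 a h) = _
    simp only [latticeSumL2, map_sum, map_smul]
    rfl
  have h1 : ∀ n : Fin d → ℤ, ∀ᵐ ξ : Rd d,
      (a n • (𝓕 (translateL2 (latticePoint n) h) : L2 d) : L2 d) ξ =
        a n * ((𝐞 (-(inner ℝ (latticePoint n) ξ)) : Circle) : ℂ) * (𝓕 h : L2 d) ξ := by
    intro n
    filter_upwards [Lp.coeFn_smul (a n) (𝓕 (translateL2 (latticePoint n) h) : L2 d),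
      fourier_translateL2 (latticePoint n) h] with x h1 h2
    rw [h1, Pi.smul_apply, h2, smul_eq_mul, mul_assoc]
  filter_upwards [ae_all_iff.2 h1, Lp.coeFn_finsetSum a.support
    (fun n => a n • (𝓕 (translateL2 (latticePoint n) h) : L2 d))] with x hx h2
  rw [h0, h2, Finset.sum_apply, trigPoly, Finset.sum_mul]
  exact Finset.sum_congr rfl fun n _ => hx n

theorem enorm_sq_eq_lintegral {d : ℕ} (f : L2 d) : ‖f‖ₑ ^ 2 = ∫⁻ x, ‖f x‖ₑ ^ 2 := by
  have := eLpNorm_nnreal_pow_eq_lintegral (f := f) (μ := (volume : Measure (Rd d)))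
    (p := 2) two_ne_zero
  rw [Lp.enorm_def]
  simpa using this

theorem enorm_latticeSumL2_sq {d : ℕ} (a : (Fin d → ℤ) →₀ ℂ) (h : L2 d) :
    ‖latticeSumL2 a h‖ₑ ^ 2 = ∫⁻ ξ, ‖trigPoly a ξ‖ₑ ^ 2 * ‖(𝓕 h : L2 d) ξ‖ₑ ^ 2 := by
  have h1 : ‖latticeSumL2 a h‖ₑ = ‖(𝓕 (latticeSumL2 a h) : L2 d)‖ₑ := by
    rw [← ofReal_norm, ← ofReal_norm, Lp.norm_fourier_eq]
  rw [h1, enorm_sq_eq_lintegral]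
  refine lintegral_congr_ae ?_
  filter_upwards [fourier_latticeSumL2 a h] with ξ hξ
  rw [hξ, enorm_mul, mul_pow]

theorem ae_comp_smul {d : ℕ} {c : ℝ} (hc : c ≠ 0) {p : Rd d → Prop} (h : ∀ᵐ ω, p ω) :
    ∀ᵐ ξ : Rd d, p (c • ξ) := by
  have hq : Measure.QuasiMeasurePreserving (fun ξ : Rd d => c • ξ) volume volume := by
    refine ⟨by fun_prop, ?_⟩
    have := Measure.map_addHaar_smul (volume : Measure (Rd d)) hc
    change Measure.map (c • ·) volume ≪ volume
    rw [this]
    exact Measure.smul_absolutelyContinuous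
  exact hq.ae h

theorem fourierL2_two_pi_smul {d : ℕ} (h : L2 d) (ξ : Rd d) (k : Fin d → ℤ) :
    fourierL2 h ((2 * Real.pi) • ξ - (2 * Real.pi) • latticePoint k) =
      (𝓕 h : L2 d) (ξ - latticePoint k) := by
  have hne : (2 * Real.pi) ≠ 0 := by positivity
  rw [fourierL2, ← smul_sub, inv_smul_smul₀ hne]

/-- The lower Riesz bound: the coefficients are controlled by the `L²` norm of
`∑ n, a_n φ(· - n)`. -/
theorem RieszCondition.exists_coeffNormSq_le {d : ℕ} {φ : L2 d} (hφ : RieszCondition φ) :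
    ∃ C : ℝ≥0, ∀ a : (Fin d → ℤ) →₀ ℂ, coeffNormSq a ≤ C * ‖latticeSumL2 a φ‖ₑ ^ 2 := by
  obtain ⟨A, B, hA, -, hAB⟩ := hφ
  refine ⟨A.toNNReal⁻¹, fun a => ?_⟩
  have h1 : ENNReal.ofReal A * coeffNormSq a ≤ ‖latticeSumL2 a φ‖ₑ ^ 2 := by
    rw [enorm_latticeSumL2_sq]
    refine le_lintegral_trigPoly_mul a ?_ ?_
    · exact (Lp.aestronglyMeasurable (𝓕 φ : L2 d)).enorm.pow_const 2
    · filter_upwards [ae_comp_smul Real.two_pi_pos.ne' hAB] with ξ hξ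
      simpa only [fourierL2_two_pi_smul] using hξ.1
  have hne : A.toNNReal ≠ 0 := by simpa using hA
  rw [ENNReal.coe_inv hne, mul_comm, ← div_eq_mul_inv, ENNReal.le_div_iff_mul_le]
  · rw [mul_comm]
    exact h1
  · left; exact_mod_cast hne
  · left; exact ENNReal.coe_ne_top

/-! ### Decay of the kernel with transform `∏ (1 + ξ_i²)^{-α}` -/

theorem integrable_one_add_sq_rpow {α : ℝ} (hα : 1 / 2 < α) :
    Integrable (fun t : ℝ => (1 + t ^ 2) ^ (-α)) := by
  have h := integrable_rpow_neg_one_add_norm_sq (E := ℝ) (μ := volume) (r := 2 * α)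
    (by simp; linarith)
  refine h.congr (Filter.Eventually.of_forall fun t => ?_)
  simp only [Real.norm_eq_abs, sq_abs]
  congr 1
  ring

theorem hasDerivAt_one_add_sq_rpow (β t : ℝ) :
    HasDerivAt (fun t : ℝ => (1 + t ^ 2) ^ (-β)) (-(2 * β) * (t * (1 + t ^ 2) ^ (-(β + 1)))) t := by
  have h1 : HasDerivAt (fun t : ℝ => 1 + t ^ 2) (2 * t) t := by
    simpa using (hasDerivAt_pow 2 t).const_add 1
  have h2 := h1.rpow_const (p := -β) (Or.inl (by positivity))
  convert h2 using 1
  rw [show -β - 1 = -(β + 1) by ring]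
  ring

theorem one_add_sq_rpow_bound (β t : ℝ) :
    ‖(1 + t ^ 2) ^ (-(β + 1))‖ ≤ (1 + t ^ 2) ^ (-β) ∧
    ‖t * (1 + t ^ 2) ^ (-(β + 1))‖ ≤ (1 + t ^ 2) ^ (-β) ∧
    ‖t ^ 2 * (1 + t ^ 2) ^ (-(β + 1))‖ ≤ (1 + t ^ 2) ^ (-β) := by
  have hpos : (0 : ℝ) < 1 + t ^ 2 := by positivity
  have h0 : (1 + t ^ 2) ^ (-β) = (1 + t ^ 2) ^ (-(β + 1)) * (1 + t ^ 2) := by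
    rw [← Real.rpow_add_one hpos.ne']
    ring_nf
  have hp : 0 < (1 + t ^ 2) ^ (-(β + 1)) := Real.rpow_pos_of_pos hpos _
  refine ⟨?_, ?_, ?_⟩
  · rw [h0, Real.norm_of_nonneg hp.le]
    nlinarith [sq_nonneg t]
  · rw [h0, norm_mul, Real.norm_of_nonneg hp.le, mul_comm, Real.norm_eq_abs]
    refine mul_le_mul_of_nonneg_left ?_ hp.le
    nlinarith [sq_abs t, sq_nonneg (|t| - 1), abs_nonneg t]
  · rw [h0, norm_mul, Real.norm_of_nonneg hp.le, mul_comm, Real.norm_of_nonneg (sq_nonneg t)]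
    refine mul_le_mul_of_nonneg_left ?_ hp.le
    linarith

theorem continuous_one_add_sq_rpow (β : ℝ) : Continuous fun t : ℝ => (1 + t ^ 2) ^ (-β) :=
  Continuous.rpow_const (by fun_prop) fun t => Or.inl (by positivity)

/-- The Fourier transform of `(1 + t²)^{-α}` is `O((1 + x²)⁻¹)`, because the function and its
first two derivatives are integrable. -/
theorem exists_fourier_one_add_sq_rpow_le {α : ℝ} (hα : 1 / 2 < α) :
    ∃ C : ℝ, 0 < C ∧ ∀ x : ℝ,
      ‖𝓕 (fun t : ℝ => (((1 + t ^ 2) ^ (-α) : ℝ) : ℂ)) x‖ ≤ C / (1 + x ^ 2) := by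
  set u : ℝ → ℝ := fun t => (1 + t ^ 2) ^ (-α) with hu
  set u1 : ℝ → ℝ := fun t => -(2 * α) * (t * (1 + t ^ 2) ^ (-(α + 1))) with hu1
  set u2 : ℝ → ℝ := fun t => -(2 * α) * (1 * (1 + t ^ 2) ^ (-(α + 1)) +
    t * (-(2 * (α + 1)) * (t * (1 + t ^ 2) ^ (-(α + 1 + 1))))) with hu2
  have d1 : ∀ t, HasDerivAt u (u1 t) t := fun t => hasDerivAt_one_add_sq_rpow α t
  have d2 : ∀ t, HasDerivAt u1 (u2 t) t := fun t =>
    ((hasDerivAt_id t).mul (hasDerivAt_one_add_sq_rpow (α + 1) t)).const_mul _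
  have iu : Integrable u := integrable_one_add_sq_rpow hα
  have c0 := continuous_one_add_sq_rpow α
  have c1 := continuous_one_add_sq_rpow (α + 1)
  have c2 := continuous_one_add_sq_rpow (α + 1 + 1)
  have i1 : Integrable u1 := by
    refine (iu.mono' ?_ (Filter.Eventually.of_forall fun t =>
      (one_add_sq_rpow_bound α t).2.1)).const_mul (-(2 * α))
    exact (continuous_id.mul c1).aestronglyMeasurable
  have i2 : Integrable u2 := by
    refine Integrable.const_mul (Integrable.add ?_ ?_) _
    · refine iu.mono' (by simpa using c1.aestronglyMeasurable)
        (Filter.Eventually.of_forall fun t => ?_)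
      simpa using (one_add_sq_rpow_bound α t).1
    · have : Integrable (fun t : ℝ => t ^ 2 * (1 + t ^ 2) ^ (-(α + 1 + 1))) := by
        refine iu.mono' ((continuous_pow 2).mul c2).aestronglyMeasurable
          (Filter.Eventually.of_forall fun t => ?_)
        exact (one_add_sq_rpow_bound (α + 1) t).2.2.trans
          ((le_abs_self _).trans (one_add_sq_rpow_bound α t).1)
      refine (this.const_mul (-(2 * (α + 1)))).congr (Filter.Eventually.of_forall fun t => ?_)
      simp only
      ring
  let v : ℝ → ℂ := fun t => (u t : ℂ)
  let v1 : ℝ → ℂ := fun t => (u1 t : ℂ)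
  let v2 : ℝ → ℂ := fun t => (u2 t : ℂ)
  have e1 : ∀ t, HasDerivAt v (v1 t) t := fun t => (d1 t).ofReal_comp
  have e2 : ∀ t, HasDerivAt v1 (v2 t) t := fun t => (d2 t).ofReal_comp
  have D1 : deriv v = v1 := funext fun t => (e1 t).deriv
  have D2 : deriv v1 = v2 := funext fun t => (e2 t).deriv
  have F1 : 𝓕 v1 = fun x : ℝ => (2 * Real.pi * Complex.I * x) • 𝓕 v x := by
    rw [← D1]
    exact Real.fourier_deriv iu.ofReal (fun t => (e1 t).differentiableAt)
      (by rw [D1]; exact i1.ofReal)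
  have F2 : 𝓕 v2 = fun x : ℝ => (2 * Real.pi * Complex.I * x) • 𝓕 v1 x := by
    rw [← D2]
    exact Real.fourier_deriv i1.ofReal (fun t => (e2 t).differentiableAt)
      (by rw [D2]; exact i2.ofReal)
  have b : ∀ (w : ℝ → ℂ) (x : ℝ), ‖𝓕 w x‖ ≤ ∫ t, ‖w t‖ := fun w x =>
    VectorFourier.norm_fourierIntegral_le_integral_norm _ _ _ _ _
  have n0 : 0 ≤ ∫ t, ‖v t‖ := integral_nonneg fun _ => norm_nonneg _
  have n2 : 0 ≤ ∫ t, ‖v2 t‖ := integral_nonneg fun _ => norm_nonneg _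
  refine ⟨(∫ t, ‖v t‖) + (∫ t, ‖v2 t‖) + 1, by positivity, fun x => ?_⟩
  rw [le_div_iff₀ (by positivity)]
  have h2 : (2 * Real.pi) ^ 2 * x ^ 2 * ‖𝓕 v x‖ ≤ ∫ t, ‖v2 t‖ := by
    refine le_trans (le_of_eq ?_) (b v2 x)
    rw [F2, F1]
    simp only [smul_eq_mul, norm_mul, Complex.norm_I, Complex.norm_real, RCLike.norm_ofNat,
      Real.norm_eq_abs, abs_of_pos Real.pi_pos]
    rw [← sq_abs x]
    ring
  have h3 : x ^ 2 * ‖𝓕 v x‖ ≤ (2 * Real.pi) ^ 2 * x ^ 2 * ‖𝓕 v x‖ := by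
    have : (1 : ℝ) ≤ (2 * Real.pi) ^ 2 := by nlinarith [Real.pi_gt_three]
    nlinarith [mul_nonneg (sq_nonneg x) (norm_nonneg (𝓕 v x))]
  have := b v x
  change ‖𝓕 v x‖ * (1 + x ^ 2) ≤ _
  nlinarith

/-- The weight `v^{-2α}`, written as a product of functions of one variable. -/
noncomputable def besselSymbol {d : ℕ} (α : ℝ) (ξ : Rd d) : ℝ :=
  ∏ i, (1 + (ξ i) ^ 2) ^ (-α)

theorem weight_pos {d : ℕ} (ξ : Rd d) : 0 < weight ξ :=
  Finset.prod_pos fun i _ => Real.sqrt_pos.2 (by positivity)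

theorem continuous_weight {d : ℕ} : Continuous (weight : Rd d → ℝ) := by
  unfold weight
  fun_prop

theorem besselSymbol_eq {d : ℕ} (α : ℝ) (ξ : Rd d) :
    besselSymbol α ξ = ((weight ξ ^ α) ⁻¹) ^ 2 := by
  rw [besselSymbol, weight, ← Real.finsetProd_rpow _ _ (fun _ _ => Real.sqrt_nonneg _),
    ← Finset.prod_inv_distrib, ← Finset.prod_pow]
  refine Finset.prod_congr rfl fun i _ => ?_
  have h : (0 : ℝ) < 1 + (ξ i) ^ 2 := by positivity
  rw [inv_pow, Real.sqrt_eq_rpow, ← Real.rpow_mul h.le, ← Real.rpow_mul_natCast h.le,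
    Real.rpow_neg h.le]
  congr 2
  push_cast
  ring

theorem integrable_besselSymbol {d : ℕ} {α : ℝ} (hα : 1 / 2 < α) :
    Integrable (besselSymbol α : Rd d → ℝ) := by
  have h : Integrable (fun x : Fin d → ℝ => ∏ i, (1 + (x i) ^ 2) ^ (-α)) :=
    Integrable.fintype_prod (f := fun (_ : Fin d) (t : ℝ) => (1 + t ^ 2) ^ (-α))
      fun _ => integrable_one_add_sq_rpow hα
  exact (EuclideanSpace.volume_preserving_symm_measurableEquiv_toLp
    (Fin d)).integrable_comp_of_integrable h

/-- The Fourier transform of `v^{-2α}` is `O(∏ (1 + x_i²)⁻¹)`, by Fubini. -/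
theorem exists_fourier_besselSymbol_le {d : ℕ} {α : ℝ} (hα : 1 / 2 < α) :
    ∃ C : ℝ, 0 < C ∧ ∀ x : Rd d,
      ‖∫ ξ : Rd d, ((𝐞 (inner ℝ x ξ) : Circle) : ℂ) * (besselSymbol α ξ : ℂ)‖ ≤
        ∏ i, (C / (1 + (x i) ^ 2)) := by
  obtain ⟨C, hC, h⟩ := exists_fourier_one_add_sq_rpow_le hα
  refine ⟨C, hC, fun x => ?_⟩
  have h1 : (∫ ξ : Rd d, ((𝐞 (inner ℝ x ξ) : Circle) : ℂ) * (besselSymbol α ξ : ℂ)) =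
      ∏ i, 𝓕 (fun t : ℝ => (((1 + t ^ 2) ^ (-α) : ℝ) : ℂ)) (-(x i)) := by
    simp_rw [Real.fourier_real_eq]
    rw [← integral_fintype_prod_volume_eq_prod (fun (i : Fin d) (t : ℝ) =>
      𝐞 (-(t * -(x i))) • (((1 + t ^ 2) ^ (-α) : ℝ) : ℂ))]
    rw [← (EuclideanSpace.volume_preserving_symm_measurableEquiv_toLp
      (Fin d)).integral_comp (MeasurableEquiv.measurableEmbedding _)]
    refine integral_congr_ae (Filter.Eventually.of_forall fun ξ => ?_)
    simp only [Circle.smul_def, smul_eq_mul, Finset.prod_mul_distrib]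
    congr 1
    · simp only [Real.fourierChar_apply, ← Complex.exp_sum]
      congr 1
      simp only [PiLp.inner_apply, RCLike.inner_apply, conj_trivial]
      push_cast
      rw [Finset.mul_sum, Finset.sum_mul]
      refine Finset.sum_congr rfl fun i _ => ?_
      simp
    · simp [besselSymbol]
  rw [h1, norm_prod]
  refine Finset.prod_le_prod (fun _ _ => norm_nonneg _) fun i _ => ?_
  simpa using h (-(x i))

/-! ### Sampling of functions with dominating mixed smoothness -/

/-- The window around the lattice point `k`: an open ball that contains the `1`-neighbourhood of
the cell `k`. -/
def window {d : ℕ} (k : Fin d → ℤ) : Set (Rd d) := Metric.ball (latticePoint k) (d + 2)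

theorem measurableSet_window {d : ℕ} (k : Fin d → ℤ) : MeasurableSet (window k) :=
  Metric.isOpen_ball.measurableSet

theorem summable_inv_one_add_int_sq : Summable fun m : ℤ => (1 + (m : ℝ) ^ 2)⁻¹ := by
  have h1 : Summable fun m : ℤ => 1 / (m : ℝ) ^ 2 + if m = 0 then (1 : ℝ) else 0 :=
    (Real.summable_one_div_int_pow.2 one_lt_two).add (hasSum_ite_eq 0 1).summable
  refine h1.of_nonneg_of_le (fun m => by positivity) fun m => ?_
  by_cases hm : m = 0
  · simp [hm]
  · rw [if_neg hm, add_zero, one_div]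
    have : (0 : ℝ) < (m : ℝ) ^ 2 := by positivity
    exact inv_anti₀ this (by linarith)

/-- The product decay `∏ C / (1 + m_i²)` is summable over the lattice. -/
theorem exists_sum_prod_le (d : ℕ) {C : ℝ} (hC : 0 ≤ C) :
    ∃ G : ℝ, 0 < G ∧ ∀ S : Finset (Fin d → ℤ),
      ∑ m ∈ S, ∏ i, (C / (1 + (m i : ℝ) ^ 2)) ≤ G := by
  have hs : Summable fun m : ℤ => C / (1 + (m : ℝ) ^ 2) := by
    simpa [div_eq_mul_inv] using summable_inv_one_add_int_sq.mul_left C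
  have h0 : 0 ≤ ∑' m : ℤ, C / (1 + (m : ℝ) ^ 2) := tsum_nonneg fun m => by positivity
  refine ⟨(∏ _i : Fin d, ∑' m : ℤ, C / (1 + (m : ℝ) ^ 2)) + 1, ?_, fun S => ?_⟩
  · have := Finset.prod_nonneg (s := Finset.univ) fun (_ : Fin d) _ => h0
    linarith
  have h1 : S ⊆ Fintype.piFinset fun i => S.image fun m : Fin d → ℤ => m i := by
    intro m hm
    exact Fintype.mem_piFinset.2 fun i => Finset.mem_image_of_mem _ hm
  calc ∑ m ∈ S, ∏ i, (C / (1 + (m i : ℝ) ^ 2))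
      ≤ ∑ m ∈ Fintype.piFinset fun i : Fin d => S.image fun m : Fin d → ℤ => m i,
          ∏ i, (C / (1 + (m i : ℝ) ^ 2)) :=
        Finset.sum_le_sum_of_subset_of_nonneg h1 fun m _ _ =>
          Finset.prod_nonneg fun i _ => by positivity
    _ = ∏ i, ∑ n ∈ S.image (fun m : Fin d → ℤ => m i), C / (1 + ((n : ℤ) : ℝ) ^ 2) :=
        (Finset.prod_univ_sum _ fun (_ : Fin d) (n : ℤ) => C / (1 + (n : ℝ) ^ 2)).symm
    _ ≤ ∏ _i : Fin d, ∑' m : ℤ, C / (1 + (m : ℝ) ^ 2) :=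
        Finset.prod_le_prod (fun i _ => Finset.sum_nonneg fun n _ => by positivity)
          fun i _ => hs.sum_le_tsum _ fun n _ => by positivity
    _ ≤ _ := by linarith

/-- Schur's test for a convolution kernel on the lattice. -/
theorem sum_mul_mul_le {d : ℕ} {γ : (Fin d → ℤ) → ℝ} (hγ : ∀ m, 0 ≤ γ m) {G : ℝ}
    (hG : ∀ S : Finset (Fin d → ℤ), ∑ m ∈ S, γ m ≤ G) (S : Finset (Fin d → ℤ))
    (c : (Fin d → ℤ) → ℝ) :
    ∑ k ∈ S, ∑ l ∈ S, c k * c l * γ (k - l) ≤ G * ∑ k ∈ S, c k ^ 2 := by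
  have h1 : ∀ k ∈ S, ∑ l ∈ S, γ (k - l) ≤ G := by
    intro k _
    refine le_trans (le_of_eq ?_) (hG (S.image fun l => k - l))
    rw [Finset.sum_image]
    intro a _ b _ hab
    exact sub_right_injective hab
  have h2 : ∀ l ∈ S, ∑ k ∈ S, γ (k - l) ≤ G := by
    intro l _
    refine le_trans (le_of_eq ?_) (hG (S.image fun k => k - l))
    rw [Finset.sum_image]
    intro a _ b _ hab
    exact sub_left_injective hab
  calc ∑ k ∈ S, ∑ l ∈ S, c k * c l * γ (k - l)
      ≤ ∑ k ∈ S, ∑ l ∈ S, (c k ^ 2 / 2 * γ (k - l) + c l ^ 2 / 2 * γ (k - l)) := by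
        refine Finset.sum_le_sum fun k _ => Finset.sum_le_sum fun l _ => ?_
        rw [← add_mul]
        exact mul_le_mul_of_nonneg_right (by nlinarith [sq_nonneg (c k - c l)]) (hγ _)
    _ = ∑ k ∈ S, c k ^ 2 / 2 * ∑ l ∈ S, γ (k - l) +
          ∑ l ∈ S, c l ^ 2 / 2 * ∑ k ∈ S, γ (k - l) := by
        simp only [Finset.sum_add_distrib, Finset.mul_sum]
        congr 1
        exact Finset.sum_comm
    _ ≤ ∑ k ∈ S, c k ^ 2 / 2 * G + ∑ l ∈ S, c l ^ 2 / 2 * G := by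
        gcongr with k hk l hl
        · exact h1 k hk
        · exact h2 l hl
    _ = G * ∑ k ∈ S, c k ^ 2 := by
        rw [← Finset.sum_add_distrib, Finset.mul_sum]
        exact Finset.sum_congr rfl fun k _ => by ring

theorem integrable_fourierChar_mul {d : ℕ} {f : Rd d → ℂ} (hf : Integrable f) (x : Rd d) :
    Integrable fun ξ : Rd d => ((𝐞 (inner ℝ x ξ) : Circle) : ℂ) * f ξ := by
  refine hf.mono ?_ (Filter.Eventually.of_forall fun ξ => ?_)
  · exact (Continuous.aestronglyMeasurable (by fun_prop)).mul hf.1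
  · rw [norm_mul]
    exact le_of_eq (by rw [Circle.norm_coe, one_mul])

theorem continuous_integral_fourierChar_mul {d : ℕ} {f : Rd d → ℂ} (hf : Integrable f) :
    Continuous fun x : Rd d => ∫ ξ : Rd d, ((𝐞 (inner ℝ x ξ) : Circle) : ℂ) * f ξ := by
  refine continuous_of_dominated (bound := fun ξ => ‖f ξ‖)
    (fun x => (integrable_fourierChar_mul hf x).1)
    (fun x => Filter.Eventually.of_forall fun ξ => ?_) hf.norm
    (Filter.Eventually.of_forall fun ξ => by fun_prop)
  rw [norm_mul]
  exact le_of_eq (by rw [Circle.norm_coe, one_mul])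

/-- The generalized trigonometric polynomials `v^{-α} ∑ c_k e^{2π i x_k·ξ}` with well-separated
frequencies are bounded in `L²` by the `ℓ²` norm of `c`: the Gram matrix of the exponentials
consists of values of the transform of `v^{-2α}`. -/
theorem exists_integral_exponential_sum_le (d : ℕ) {α : ℝ} (hα : 1 / 2 < α) :
    ∃ G : ℝ, 0 < G ∧ ∀ (S : Finset (Fin d → ℤ)) (x : (Fin d → ℤ) → Rd d) (c : (Fin d → ℤ) → ℂ),
      (∀ k ∈ S, ‖x k - latticePoint k‖ ≤ d + 2) →
      Integrable (fun ξ : Rd d => besselSymbol α ξ *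
        ‖∑ k ∈ S, c k * ((𝐞 (inner ℝ (x k) ξ) : Circle) : ℂ)‖ ^ 2) ∧
      ∫ ξ : Rd d, besselSymbol α ξ *
        ‖∑ k ∈ S, c k * ((𝐞 (inner ℝ (x k) ξ) : Circle) : ℂ)‖ ^ 2 ≤ G * ∑ k ∈ S, ‖c k‖ ^ 2 := by
  obtain ⟨C, hC, hK⟩ := exists_fourier_besselSymbol_le (d := d) hα
  set ρ : ℝ := 2 * (d + 2) with hρ
  obtain ⟨G, hG, hsum⟩ := exists_sum_prod_le d (C := C * (2 + 2 * ρ ^ 2)) (by positivity)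
  refine ⟨G, hG, fun S x c hx => ?_⟩
  let K : Rd d → ℂ := fun y =>
    ∫ ξ : Rd d, ((𝐞 (inner ℝ y ξ) : Circle) : ℂ) * (besselSymbol α ξ : ℂ)
  have hI : ∀ y, Integrable fun ξ : Rd d =>
      ((𝐞 (inner ℝ y ξ) : Circle) : ℂ) * (besselSymbol α ξ : ℂ) := fun y =>
    integrable_fourierChar_mul (integrable_besselSymbol hα).ofReal y
  have hexp : ∀ ξ : Rd d, ((besselSymbol α ξ *
        ‖∑ k ∈ S, c k * ((𝐞 (inner ℝ (x k) ξ) : Circle) : ℂ)‖ ^ 2 : ℝ) : ℂ) =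
      ∑ k ∈ S, ∑ l ∈ S, c k * (starRingEnd ℂ) (c l) *
        (((𝐞 (inner ℝ (x k - x l) ξ) : Circle) : ℂ) * (besselSymbol α ξ : ℂ)) := by
    intro ξ
    rw [Complex.ofReal_mul, Complex.ofReal_pow, ← Complex.mul_conj', map_sum,
      Finset.sum_mul_sum, Finset.mul_sum]
    refine Finset.sum_congr rfl fun k _ => ?_
    rw [Finset.mul_sum]
    refine Finset.sum_congr rfl fun l _ => ?_
    rw [inner_sub_left, sub_eq_add_neg, AddChar.map_add_eq_mul, AddChar.map_neg_eq_inv,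
      Circle.coe_mul, Circle.coe_inv_eq_conj, map_mul]
    ring
  have hint : Integrable (fun ξ : Rd d => ((besselSymbol α ξ *
        ‖∑ k ∈ S, c k * ((𝐞 (inner ℝ (x k) ξ) : Circle) : ℂ)‖ ^ 2 : ℝ) : ℂ)) := by
    simp_rw [hexp]
    exact integrable_finsetSum _ fun k _ => integrable_finsetSum _ fun l _ =>
      (hI _).const_mul _
  have hdec : ∀ k ∈ S, ∀ l ∈ S, ‖K (x k - x l)‖ ≤
      ∏ i, (C * (2 + 2 * ρ ^ 2) / (1 + (((k - l) i : ℤ) : ℝ) ^ 2)) := by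
    intro k hk l hl
    refine (hK _).trans (Finset.prod_le_prod (fun i _ => by positivity) fun i _ => ?_)
    have h1 : |(x k - x l) i - (((k - l) i : ℤ) : ℝ)| ≤ ρ := by
      have h2 := (PiLp.norm_apply_le (x k - latticePoint k) i).trans (hx k hk)
      have h3 := (PiLp.norm_apply_le (x l - latticePoint l) i).trans (hx l hl)
      simp only [PiLp.sub_apply, latticePoint_apply, Real.norm_eq_abs, Pi.sub_apply,
        Int.cast_sub, abs_le] at *
      constructor <;> linarith [h2.1, h2.2, h3.1, h3.2]
    set y : ℝ := (x k - x l) i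
    set m : ℝ := (((k - l) i : ℤ) : ℝ)
    have h4 : (y - m) ^ 2 ≤ ρ ^ 2 := sq_le_sq' (abs_le.1 h1).1 (abs_le.1 h1).2
    have h5 : 1 + m ^ 2 ≤ (2 + 2 * ρ ^ 2) * (1 + y ^ 2) := by
      nlinarith [sq_nonneg (2 * y - m), mul_nonneg (sq_nonneg ρ) (sq_nonneg y)]
    rw [div_le_div_iff₀ (by positivity) (by positivity), mul_assoc]
    exact mul_le_mul_of_nonneg_left h5 hC.le
  refine ⟨?_, ?_⟩
  · have := hint.re
    simp only [RCLike.re_to_complex, Complex.ofReal_re] at this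
    exact this
  calc ∫ ξ : Rd d, besselSymbol α ξ *
        ‖∑ k ∈ S, c k * ((𝐞 (inner ℝ (x k) ξ) : Circle) : ℂ)‖ ^ 2
      ≤ ‖((∫ ξ : Rd d, besselSymbol α ξ *
        ‖∑ k ∈ S, c k * ((𝐞 (inner ℝ (x k) ξ) : Circle) : ℂ)‖ ^ 2 : ℝ) : ℂ)‖ := by
        rw [Complex.norm_real]
        exact le_abs_self _
    _ = ‖∑ k ∈ S, ∑ l ∈ S, c k * (starRingEnd ℂ) (c l) * K (x k - x l)‖ := by
        rw [← integral_complex_ofReal]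
        simp_rw [hexp]
        rw [integral_finsetSum _ fun k _ => integrable_finsetSum _ fun l _ =>
          (hI _).const_mul _]
        congr 1
        refine Finset.sum_congr rfl fun k _ => ?_
        rw [integral_finsetSum _ fun l _ => (hI _).const_mul _]
        exact Finset.sum_congr rfl fun l _ => integral_const_mul _ _
    _ ≤ ∑ k ∈ S, ∑ l ∈ S, ‖c k‖ * ‖c l‖ *
          ∏ i, (C * (2 + 2 * ρ ^ 2) / (1 + (((k - l) i : ℤ) : ℝ) ^ 2)) := by
        refine (norm_sum_le _ _).trans (Finset.sum_le_sum fun k hk =>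
          (norm_sum_le _ _).trans (Finset.sum_le_sum fun l hl => ?_))
        rw [norm_mul, norm_mul, RCLike.norm_conj]
        exact mul_le_mul_of_nonneg_left (hdec k hk l hl) (by positivity)
    _ ≤ G * ∑ k ∈ S, ‖c k‖ ^ 2 :=
        sum_mul_mul_le (γ := fun m => ∏ i, (C * (2 + 2 * ρ ^ 2) / (1 + ((m i : ℤ) : ℝ) ^ 2)))
          (fun m => Finset.prod_nonneg fun i _ => by positivity) hsum S fun k => ‖c k‖

/-- The multiplier `v^{-α}` is square integrable. -/
theorem memLp_inv_weight_rpow (d : ℕ) {α : ℝ} (hα : 1 / 2 < α) :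
    MemLp (fun ξ : Rd d => (weight ξ ^ α)⁻¹) 2 volume := by
  have hc : Continuous fun ξ : Rd d => (weight ξ ^ α)⁻¹ :=
    (continuous_weight.rpow_const fun ξ => Or.inl (weight_pos ξ).ne').inv₀
      fun ξ => (Real.rpow_pos_of_pos (weight_pos ξ) _).ne'
  rw [memLp_two_iff_integrable_sq hc.aestronglyMeasurable]
  simp_rw [← besselSymbol_eq]
  exact integrable_besselSymbol hα

/-- The sampling inequality `∑ ‖F(x_k)‖² ≤ G ‖U‖²` for `F̂ = v^{-α} U` and points `x_k` close to
the lattice points `k`, by duality with `exists_integral_exponential_sum_le`. -/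
theorem exists_sum_sampling_le (d : ℕ) {α : ℝ} (hα : 1 / 2 < α) :
    ∃ G : ℝ, 0 < G ∧ ∀ (U : Rd d → ℂ), MemLp U 2 volume →
      ∀ (S : Finset (Fin d → ℤ)) (x : (Fin d → ℤ) → Rd d),
      (∀ k ∈ S, ‖x k - latticePoint k‖ ≤ d + 2) →
      ∑ k ∈ S, ‖∫ ξ : Rd d, ((𝐞 (inner ℝ (x k) ξ) : Circle) : ℂ) *
        ((((weight ξ ^ α)⁻¹ : ℝ) : ℂ) * U ξ)‖ ^ 2 ≤ G * ∫ ξ, ‖U ξ‖ ^ 2 := by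
  obtain ⟨G, hG, h⟩ := exists_integral_exponential_sum_le d hα
  refine ⟨G, hG, fun U hU S x hx => ?_⟩
  have hWU : Integrable fun ξ : Rd d => (((weight ξ ^ α)⁻¹ : ℝ) : ℂ) * U ξ :=
    (memLp_inv_weight_rpow d hα).ofReal.integrable_mul hU
  set F : (Fin d → ℤ) → ℂ := fun k => ∫ ξ : Rd d, ((𝐞 (inner ℝ (x k) ξ) : Circle) : ℂ) *
    ((((weight ξ ^ α)⁻¹ : ℝ) : ℂ) * U ξ) with hF
  let c : (Fin d → ℤ) → ℂ := fun k => (starRingEnd ℂ) (F k)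
  let E : Rd d → ℂ := fun ξ => ∑ k ∈ S, c k * ((𝐞 (inner ℝ (x k) ξ) : Circle) : ℂ)
  obtain ⟨hEi, hE⟩ := h S x c hx
  have hUi : Integrable fun ξ => ‖U ξ‖ ^ 2 := hU.integrable_norm_pow two_ne_zero
  have hc : ∑ k ∈ S, ‖c k‖ ^ 2 = ∑ k ∈ S, ‖F k‖ ^ 2 := by simp only [c, RCLike.norm_conj]
  have h1 : ((∑ k ∈ S, ‖F k‖ ^ 2 : ℝ) : ℂ) =
      ∫ ξ : Rd d, E ξ * ((((weight ξ ^ α)⁻¹ : ℝ) : ℂ) * U ξ) := by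
    have : ∀ ξ : Rd d, E ξ * ((((weight ξ ^ α)⁻¹ : ℝ) : ℂ) * U ξ) =
        ∑ k ∈ S, c k * (((𝐞 (inner ℝ (x k) ξ) : Circle) : ℂ) *
          ((((weight ξ ^ α)⁻¹ : ℝ) : ℂ) * U ξ)) := by
      intro ξ
      simp only [E, Finset.sum_mul, mul_assoc]
    simp_rw [this]
    rw [integral_finsetSum _ fun k _ => (integrable_fourierChar_mul hWU (x k)).const_mul _]
    push_cast
    refine Finset.sum_congr rfl fun k _ => ?_
    rw [integral_const_mul, ← Complex.conj_mul']
    simp only [c, hF, Complex.ofReal_inv]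
  have h2 : ∑ k ∈ S, ‖F k‖ ^ 2 ≤ ∫ ξ : Rd d, (G / 2 * ‖U ξ‖ ^ 2 +
      1 / (2 * G) * (besselSymbol α ξ * ‖E ξ‖ ^ 2)) := by
    calc ∑ k ∈ S, ‖F k‖ ^ 2 ≤ ‖((∑ k ∈ S, ‖F k‖ ^ 2 : ℝ) : ℂ)‖ := by
          rw [Complex.norm_real]; exact le_abs_self _
      _ ≤ ∫ ξ : Rd d, ‖E ξ * ((((weight ξ ^ α)⁻¹ : ℝ) : ℂ) * U ξ)‖ := by
          rw [h1]; exact norm_integral_le_integral_norm _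
      _ ≤ _ := by
          refine integral_mono_of_nonneg (Filter.Eventually.of_forall fun _ => norm_nonneg _)
            ((hUi.const_mul _).add (hEi.const_mul _)) (Filter.Eventually.of_forall fun ξ => ?_)
          have hw : 0 < (weight ξ ^ α)⁻¹ :=
            inv_pos.2 (Real.rpow_pos_of_pos (weight_pos ξ) _)
          simp only [norm_mul, Complex.norm_real, Real.norm_of_nonneg hw.le, besselSymbol_eq]
          -- weighted arithmetic-geometric mean, so that the `E` term is absorbed on the left
          have h3 : 0 ≤ (G * ‖U ξ‖ - (weight ξ ^ α)⁻¹ * ‖E ξ‖) ^ 2 / (2 * G) := by positivity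
          have h4 : (G * ‖U ξ‖ - (weight ξ ^ α)⁻¹ * ‖E ξ‖) ^ 2 / (2 * G) =
              G / 2 * ‖U ξ‖ ^ 2 + 1 / (2 * G) * ((weight ξ ^ α)⁻¹ ^ 2 * ‖E ξ‖ ^ 2) -
                ‖E ξ‖ * ((weight ξ ^ α)⁻¹ * ‖U ξ‖) := by
            field_simp
            ring
          linarith
  rw [integral_add (hUi.const_mul _) (hEi.const_mul _), integral_const_mul,
    integral_const_mul] at h2
  have h5 : 1 / (2 * G) * ∫ ξ : Rd d, besselSymbol α ξ * ‖E ξ‖ ^ 2 ≤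
      1 / (2 * G) * (G * ∑ k ∈ S, ‖F k‖ ^ 2) :=
    mul_le_mul_of_nonneg_left (hE.trans_eq (by rw [hc])) (by positivity)
  have h6 : 1 / (2 * G) * (G * ∑ k ∈ S, ‖F k‖ ^ 2) = (∑ k ∈ S, ‖F k‖ ^ 2) / 2 := by
    field_simp
  linarith

/-! ### The amalgam bound under the Sobolev type condition -/

/-- The `L²` inverse Fourier transform of an integrable function is given by the integral. -/
theorem fourierInv_ae_eq_integral {d : ℕ} (g : L2 d) (hg : Integrable g) :
    (𝓕⁻ g : L2 d) =ᵐ[volume] fun x => ∫ ξ : Rd d, ((𝐞 (inner ℝ x ξ) : Circle) : ℂ) * g ξ := by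
  have hcont := continuous_integral_fourierChar_mul hg
  refine ae_eq_of_integral_contDiff_smul_eq
    ((Lp.memLp (𝓕⁻ g : L2 d)).locallyIntegrable one_le_two) hcont.locallyIntegrable ?_
  intro η hη hηc
  let ηc : Rd d → ℂ := fun x => (η x : ℂ)
  have hηc' : HasCompactSupport ηc := hηc.comp_left Complex.ofReal_zero
  have hηs : ContDiff ℝ (⊤ : ℕ∞) ηc := Complex.ofRealCLM.contDiff.comp hη
  let σ : SchwartzMap (Rd d) ℂ := hηc'.toSchwartzMap hηs
  have hσ : ∀ x, σ x = (η x : ℂ) := fun x => rfl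
  have h1 : (𝓕⁻ (Lp.toTemperedDistribution g)) σ = Lp.toTemperedDistribution (𝓕⁻ g : L2 d) σ := by
    rw [Lp.fourierInv_toTemperedDistribution_eq]
  rw [TemperedDistribution.fourierInv_apply, Lp.toTemperedDistribution_apply,
    Lp.toTemperedDistribution_apply] at h1
  have h2 : ∫ x, η x • (𝓕⁻ g : L2 d) x = ∫ x, σ x • (𝓕⁻ g : L2 d) x := by
    refine integral_congr_ae (Filter.Eventually.of_forall fun x => ?_)
    simp only [hσ, smul_eq_mul, Complex.real_smul]
  rw [h2, ← h1]
  have h3 := VectorFourier.integral_fourierIntegral_smul_eq_flip (L := -innerₗ (Rd d))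
    (μ := volume) (ν := volume) (f := σ) (g := g)
    Real.continuous_fourierChar (by exact continuous_inner.neg) σ.integrable hg
  have h4 : ∀ ξ, (𝓕⁻ σ) ξ = VectorFourier.fourierIntegral 𝐞 volume (-innerₗ (Rd d)) σ ξ := by
    intro ξ
    rw [SchwartzMap.fourierInv_coe]
    rfl
  simp_rw [h4, h3]
  refine integral_congr_ae (Filter.Eventually.of_forall fun x => ?_)
  simp only [hσ, VectorFourier.fourierIntegral, smul_eq_mul, Complex.real_smul]
  congr 1
  refine integral_congr_ae (Filter.Eventually.of_forall fun ξ => ?_)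
  simp only [LinearMap.flip_apply, LinearMap.neg_apply, innerₗ_apply_apply, neg_neg,
    Circle.smul_def, smul_eq_mul]

theorem ae_eq_integral_fourier {d : ℕ} (H : L2 d) (hH : Integrable (𝓕 H : L2 d)) :
    H =ᵐ[volume] fun x => ∫ ξ : Rd d, ((𝐞 (inner ℝ x ξ) : Circle) : ℂ) * (𝓕 H : L2 d) ξ := by
  have h := fourierInv_ae_eq_integral (𝓕 H : L2 d) hH
  rwa [FourierTransform.fourierInv_fourier_eq] at h

/-- The squared norm of the amalgam space `W(L^∞, ℓ²)`. -/
noncomputable def amalgamNormSq {d : ℕ} (f : Rd d → ℂ) : ℝ≥0∞ :=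
  ∑' k : Fin d → ℤ, eLpNorm f ∞ (volume.restrict (window k)) ^ 2

theorem amalgamNormSq_congr_ae {d : ℕ} {f g : Rd d → ℂ} (h : f =ᵐ[volume] g) :
    amalgamNormSq f = amalgamNormSq g :=
  tsum_congr fun _ => by rw [eLpNorm_congr_ae (ae_restrict_of_ae h)]

theorem lintegral_enorm_sq_eq_ofReal {d : ℕ} {U : Rd d → ℂ} (hU : MemLp U 2 volume) :
    ∫⁻ ξ, ‖U ξ‖ₑ ^ 2 = ENNReal.ofReal (∫ ξ, ‖U ξ‖ ^ 2) := by
  rw [ofReal_integral_eq_lintegral_ofReal (hU.integrable_norm_pow two_ne_zero)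
    (Filter.Eventually.of_forall fun _ => by positivity)]
  refine lintegral_congr fun ξ => ?_
  rw [ENNReal.ofReal_pow (norm_nonneg _), ofReal_norm]

theorem memLp_two_of_lintegral_lt_top {d : ℕ} {U : Rd d → ℂ} (hm : AEStronglyMeasurable U volume)
    (h : ∫⁻ ξ, ‖U ξ‖ₑ ^ 2 < ∞) : MemLp U 2 volume := by
  refine ⟨hm, ?_⟩
  have := eLpNorm_nnreal_pow_eq_lintegral (f := U) (μ := (volume : Measure (Rd d)))
    (p := 2) two_ne_zero
  simp only [ENNReal.coe_ofNat, NNReal.coe_ofNat, ENNReal.rpow_ofNat] at this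
  rw [← this] at h
  exact (ENNReal.pow_lt_top_iff.1 h).resolve_right two_ne_zero

/-- Functions with `v^α Ĥ ∈ L²`, `α > 1/2`, belong to the amalgam space `W(L^∞, ℓ²)`. -/
theorem exists_amalgamNormSq_le_weighted (d : ℕ) {α : ℝ} (hα : 1 / 2 < α) :
    ∃ G : ℝ≥0, ∀ H : L2 d,
      ∫⁻ ξ, ‖((weight ξ ^ α : ℝ) : ℂ) * (𝓕 H : L2 d) ξ‖ₑ ^ 2 < ∞ →
      amalgamNormSq H ≤ G * ∫⁻ ξ, ‖((weight ξ ^ α : ℝ) : ℂ) * (𝓕 H : L2 d) ξ‖ₑ ^ 2 := by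
  obtain ⟨G, hG, h⟩ := exists_sum_sampling_le d hα
  refine ⟨G.toNNReal, fun H hfin => ?_⟩
  set U : Rd d → ℂ := fun ξ => ((weight ξ ^ α : ℝ) : ℂ) * (𝓕 H : L2 d) ξ with hUdef
  have hw : ∀ ξ : Rd d, 0 < weight ξ ^ α := fun ξ => Real.rpow_pos_of_pos (weight_pos ξ) _
  have hwc : Continuous fun ξ : Rd d => weight ξ ^ α :=
    continuous_weight.rpow_const fun ξ => Or.inl (weight_pos ξ).ne'
  have hU : MemLp U 2 volume := memLp_two_of_lintegral_lt_top
    ((Complex.continuous_ofReal.comp hwc).aestronglyMeasurable.mul (Lp.memLp (𝓕 H : L2 d)).1) hfin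
  have hWU : ∀ ξ, (((weight ξ ^ α)⁻¹ : ℝ) : ℂ) * U ξ = (𝓕 H : L2 d) ξ := by
    intro ξ
    rw [hUdef, ← mul_assoc, ← Complex.ofReal_mul, inv_mul_cancel₀ (hw ξ).ne', Complex.ofReal_one,
      one_mul]
  have hint : Integrable (𝓕 H : L2 d) := by
    have : Integrable fun ξ : Rd d => (((weight ξ ^ α)⁻¹ : ℝ) : ℂ) * U ξ :=
      (memLp_inv_weight_rpow d hα).ofReal.integrable_mul hU
    simpa only [hWU] using this
  set F : Rd d → ℂ := fun x => ∫ ξ : Rd d, ((𝐞 (inner ℝ x ξ) : Circle) : ℂ) * (𝓕 H : L2 d) ξ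
    with hF
  have hFc : Continuous F := continuous_integral_fourierChar_mul hint
  have hmax : ∀ k : Fin d → ℤ, ∃ y ∈ Metric.closedBall (latticePoint k : Rd d) (d + 2),
      ∀ z ∈ Metric.closedBall (latticePoint k : Rd d) (d + 2), ‖F z‖ ≤ ‖F y‖ := by
    intro k
    obtain ⟨y, hy, hmax⟩ := (isCompact_closedBall (latticePoint k : Rd d) (d + 2)).exists_isMaxOn
      ⟨_, Metric.mem_closedBall_self (by positivity)⟩ hFc.norm.continuousOn
    exact ⟨y, hy, fun z hz => hmax hz⟩
  choose x hx hxmax using hmax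
  have hle : ∀ k, eLpNorm F ∞ (volume.restrict (window k)) ≤ ‖F (x k)‖ₑ := by
    intro k
    rw [eLpNorm_exponent_top]
    refine eLpNormEssSup_le_of_ae_enorm_bound ?_
    rw [ae_restrict_iff' (measurableSet_window k)]
    refine Filter.Eventually.of_forall fun z hz => ?_
    rw [← ofReal_norm, ← ofReal_norm]
    exact ENNReal.ofReal_le_ofReal (hxmax k z (Metric.ball_subset_closedBall hz))
  rw [amalgamNormSq_congr_ae (ae_eq_integral_fourier H hint), amalgamNormSq,
    ENNReal.tsum_eq_iSup_sum]
  refine iSup_le fun S => ?_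
  calc ∑ k ∈ S, eLpNorm F ∞ (volume.restrict (window k)) ^ 2
      ≤ ∑ k ∈ S, ‖F (x k)‖ₑ ^ 2 := Finset.sum_le_sum fun k _ => by gcongr; exact hle k
    _ = ENNReal.ofReal (∑ k ∈ S, ‖F (x k)‖ ^ 2) := by
        rw [ENNReal.ofReal_sum_of_nonneg fun _ _ => by positivity]
        exact Finset.sum_congr rfl fun k _ => by
          rw [ENNReal.ofReal_pow (norm_nonneg _), ofReal_norm]
    _ ≤ ENNReal.ofReal (G * ∫ ξ, ‖U ξ‖ ^ 2) := by
        refine ENNReal.ofReal_le_ofReal ?_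
        have := h U hU S x fun k _ => by simpa [dist_eq_norm] using hx k
        simpa only [hWU] using this
    _ = G.toNNReal * ∫⁻ ξ, ‖U ξ‖ₑ ^ 2 := by
        rw [ENNReal.ofReal_mul hG.le, lintegral_enorm_sq_eq_ofReal hU]
        rfl

theorem weight_le_weight_two_pi_smul {d : ℕ} (ξ : Rd d) :
    weight ξ ≤ weight ((2 * Real.pi) • ξ) := by
  refine Finset.prod_le_prod (fun _ _ => Real.sqrt_nonneg _) fun i _ => ?_
  refine Real.sqrt_le_sqrt ?_
  have h1 : (1 : ℝ) ≤ (2 * Real.pi) ^ 2 := by nlinarith [Real.pi_gt_three]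
  simp only [PiLp.smul_apply, smul_eq_mul, mul_pow]
  nlinarith [sq_nonneg (ξ i)]

theorem SobolevCondition.exists_amalgamNormSq_le {d : ℕ} {h : L2 d} (hh : SobolevCondition h) :
    ∃ C : ℝ≥0, ∀ a : (Fin d → ℤ) →₀ ℂ, amalgamNormSq (latticeSumL2 a h) ≤ C * coeffNormSq a := by
  obtain ⟨α, B, hα, -, hB⟩ := hh
  obtain ⟨G, hG⟩ := exists_amalgamNormSq_le_weighted d hα
  refine ⟨G * B.toNNReal, fun a => ?_⟩
  have hwc : Continuous fun ξ : Rd d => weight ξ ^ α :=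
    continuous_weight.rpow_const fun ξ => Or.inl (weight_pos ξ).ne'
  have h1 : ∫⁻ ξ, ‖((weight ξ ^ α : ℝ) : ℂ) * (𝓕 (latticeSumL2 a h) : L2 d) ξ‖ₑ ^ 2 ≤
      B.toNNReal * coeffNormSq a := by
    calc ∫⁻ ξ, ‖((weight ξ ^ α : ℝ) : ℂ) * (𝓕 (latticeSumL2 a h) : L2 d) ξ‖ₑ ^ 2
        = ∫⁻ ξ, ‖trigPoly a ξ‖ₑ ^ 2 * ‖((weight ξ ^ α : ℝ) : ℂ) * (𝓕 h : L2 d) ξ‖ₑ ^ 2 := by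
          refine lintegral_congr_ae ?_
          filter_upwards [fourier_latticeSumL2 a h] with ξ hξ
          rw [hξ, mul_left_comm, enorm_mul, mul_pow]
      _ ≤ _ := by
          refine lintegral_trigPoly_mul_le a ?_ ?_
          · exact ((Complex.continuous_ofReal.comp hwc).aestronglyMeasurable.mul
              (Lp.memLp (𝓕 h : L2 d)).1).enorm.pow_const 2
          · filter_upwards [ae_comp_smul Real.two_pi_pos.ne' hB] with ξ hξ hcell
            have h2 : ∀ i, ((2 * Real.pi) • ξ : Rd d) i ∈ Set.Icc 0 (2 * Real.pi) := by
              intro i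
              have h3 := hcell i
              simp only [Pi.zero_apply, Int.cast_zero, zero_add] at h3
              have := Real.pi_pos
              simp only [PiLp.smul_apply, smul_eq_mul]
              constructor
              · nlinarith [h3.1]
              · nlinarith [h3.2]
            refine le_trans (ENNReal.tsum_le_tsum fun k => ?_) (hξ h2)
            rw [fourierL2_two_pi_smul, enorm_mul, enorm_mul]
            gcongr
            rw [← ofReal_norm, ← ofReal_norm, Complex.norm_real, Complex.norm_real,
              Real.norm_of_nonneg (Real.rpow_nonneg (weight_pos _).le _),
              Real.norm_of_nonneg (Real.rpow_nonneg (weight_pos _).le _), ← smul_sub]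
            exact ENNReal.ofReal_le_ofReal (Real.rpow_le_rpow (weight_pos _).le
              (weight_le_weight_two_pi_smul _) (by linarith))
  have hfin : coeffNormSq a < ∞ :=
    ENNReal.sum_lt_top.2 fun n _ => ENNReal.pow_lt_top enorm_lt_top
  refine (hG _ (h1.trans_lt (ENNReal.mul_lt_top ENNReal.coe_lt_top hfin))).trans ?_
  rw [ENNReal.coe_mul, mul_assoc]
  gcongr

/-! ### The amalgam bound under the Wiener condition -/

theorem one_le_dist_latticePoint {d : ℕ} {k l : Fin d → ℤ} (h : k ≠ l) :
    1 ≤ dist (latticePoint k) (latticePoint l) := by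
  obtain ⟨i, hi⟩ := Function.ne_iff.1 h
  rw [dist_eq_norm]
  refine le_trans ?_ (PiLp.norm_apply_le _ i)
  rw [PiLp.sub_apply, latticePoint_apply, latticePoint_apply, Real.norm_eq_abs]
  have : (1 : ℤ) ≤ |k i - l i| := Int.one_le_abs (sub_ne_zero.2 hi)
  exact_mod_cast this

theorem eLpNorm_top_comp_sub {d : ℕ} {h : Rd d → ℂ} (hh : AEStronglyMeasurable h volume)
    (v p : Rd d) (r : ℝ) :
    eLpNorm (fun x => h (x - v)) ∞ (volume.restrict (Metric.ball p r)) =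
      eLpNorm h ∞ (volume.restrict (Metric.ball (p - v) r)) := by
  have hmp := (measurePreserving_sub_right (volume : Measure (Rd d)) v).restrict_preimage
    (s := Metric.ball (p - v) r) Metric.isOpen_ball.measurableSet
  have hpre : (fun x : Rd d => x - v) ⁻¹' Metric.ball (p - v) r = Metric.ball p r := by
    ext x; simp [dist_eq_norm]
  rw [hpre] at hmp
  exact eLpNorm_comp_measurePreserving hh.restrict hmp

/-- Integrating the essential supremum over unit balls dominates the sum of the essential suprema
over the translates by the lattice of a ball of radius `1/2`: such a ball is contained in the unit
ball around each of its points, and the translates are disjoint. -/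
theorem tsum_eLpNorm_ball_lt_top {d : ℕ} {h : L2 d} (hh : WienerCondition h) (c : Rd d) :
    ∑' k : Fin d → ℤ, eLpNorm h ∞ (volume.restrict (Metric.ball (latticePoint k + c) (1 / 2)))
      < ∞ := by
  have hm := (Lp.memLp h).1
  set H : Rd d → ℝ≥0∞ := fun x =>
    eLpNorm (fun y => h (x + y)) ∞ (volume.restrict (Metric.ball (0 : Rd d) 1)) with hH
  have hHeq : ∀ x, H x = eLpNorm h ∞ (volume.restrict (Metric.ball x 1)) := by
    intro x
    have := eLpNorm_top_comp_sub hm (-x) 0 1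
    simp only [sub_neg_eq_add, zero_add] at this
    rw [← this, hH]
    simp only [add_comm]
  have hle : ∀ (p x : Rd d), x ∈ Metric.ball p (1 / 2) →
      eLpNorm h ∞ (volume.restrict (Metric.ball p (1 / 2))) ≤ H x := by
    intro p x hx
    rw [hHeq]
    refine eLpNorm_mono_measure _ (Measure.restrict_mono (fun y hy => ?_) le_rfl)
    rw [Metric.mem_ball] at *
    linarith [dist_triangle y p x, dist_comm x p]
  have hdisj : Pairwise (Function.onFun Disjoint
      fun k : Fin d → ℤ => Metric.ball (latticePoint k + c) (1 / 2)) := by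
    intro k l hkl
    refine Metric.ball_disjoint_ball ?_
    rw [dist_add_right]
    linarith [one_le_dist_latticePoint hkl]
  have hvol : ∀ k : Fin d → ℤ, volume (Metric.ball (latticePoint k + c) (1 / 2)) =
      volume (Metric.ball (0 : Rd d) (1 / 2)) := fun k =>
    Measure.addHaar_ball_center _ _ _
  have hv0 : volume (Metric.ball (0 : Rd d) (1 / 2)) ≠ 0 :=
    (Metric.measure_ball_pos _ _ (by norm_num)).ne'
  have key : (∑' k : Fin d → ℤ,
      eLpNorm h ∞ (volume.restrict (Metric.ball (latticePoint k + c) (1 / 2)))) *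
        volume (Metric.ball (0 : Rd d) (1 / 2)) ≤ wienerNorm h := by
    rw [← ENNReal.tsum_mul_right]
    calc ∑' k : Fin d → ℤ,
          eLpNorm h ∞ (volume.restrict (Metric.ball (latticePoint k + c) (1 / 2))) *
            volume (Metric.ball (0 : Rd d) (1 / 2))
        ≤ ∑' k : Fin d → ℤ, ∫⁻ x in Metric.ball (latticePoint k + c) (1 / 2), H x := by
          refine ENNReal.tsum_le_tsum fun k => ?_
          rw [← hvol k, ← setLIntegral_const]
          exact setLIntegral_mono' Metric.isOpen_ball.measurableSet fun x hx => hle _ x hx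
      _ = ∫⁻ x in ⋃ k : Fin d → ℤ, Metric.ball (latticePoint k + c) (1 / 2), H x :=
          (lintegral_iUnion (fun _ => Metric.isOpen_ball.measurableSet) hdisj _).symm
      _ ≤ wienerNorm h := setLIntegral_le_lintegral _ _
  by_contra htop
  rw [not_lt, top_le_iff] at htop
  rw [htop, ENNReal.top_mul hv0, top_le_iff] at key
  exact hh.ne key

theorem eLpNorm_top_le_sum_of_subset {d : ℕ} {ι : Type*} (T : Finset ι) {s : Set (Rd d)}
    {t : ι → Set (Rd d)} (hst : s ⊆ ⋃ c ∈ T, t c) (h : Rd d → ℂ) :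
    eLpNorm h ∞ (volume.restrict s) ≤ ∑ c ∈ T, eLpNorm h ∞ (volume.restrict (t c)) := by
  refine (eLpNorm_mono_measure _ (Measure.restrict_mono hst le_rfl)).trans ?_
  rw [eLpNorm_exponent_top]
  refine eLpNormEssSup_le_of_ae_enorm_bound ?_
  rw [ae_restrict_biUnion_finset_iff]
  intro c hc
  filter_upwards [ae_le_eLpNormEssSup (f := h) (μ := volume.restrict (t c))] with x hx
  refine hx.trans ?_
  rw [← eLpNorm_exponent_top]
  exact Finset.single_le_sum (f := fun c => eLpNorm h ∞ (volume.restrict (t c)))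
    (fun _ _ => zero_le) hc

theorem tsum_eLpNorm_window_lt_top {d : ℕ} {h : L2 d} (hh : WienerCondition h) :
    ∑' k : Fin d → ℤ, eLpNorm h ∞ (volume.restrict (window k)) < ∞ := by
  obtain ⟨T, hT⟩ : ∃ T : Finset (Rd d),
      Metric.ball (0 : Rd d) (d + 2) ⊆ ⋃ c ∈ T, Metric.ball c (1 / 2) := by
    obtain ⟨t, -, ht, hcov⟩ := (isCompact_closedBall (0 : Rd d) (d + 2)).finite_cover_balls
      (e := 1 / 2) (by norm_num)
    refine ⟨ht.toFinset, Metric.ball_subset_closedBall.trans (hcov.trans ?_)⟩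
    simp
  have h1 : ∀ k : Fin d → ℤ, window k ⊆ ⋃ c ∈ T, Metric.ball (latticePoint k + c) (1 / 2) := by
    intro k x hx
    have hx0 : x - latticePoint k ∈ Metric.ball (0 : Rd d) (d + 2) := by
      simpa [window, dist_eq_norm] using hx
    obtain ⟨c, hc, hxc⟩ := Set.mem_iUnion₂.1 (hT hx0)
    refine Set.mem_iUnion₂.2 ⟨c, hc, ?_⟩
    rw [Metric.mem_ball, dist_eq_norm] at *
    rwa [← sub_sub]
  calc ∑' k : Fin d → ℤ, eLpNorm h ∞ (volume.restrict (window k))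
      ≤ ∑' k : Fin d → ℤ, ∑ c ∈ T,
          eLpNorm h ∞ (volume.restrict (Metric.ball (latticePoint k + c) (1 / 2))) :=
        ENNReal.tsum_le_tsum fun k => eLpNorm_top_le_sum_of_subset T (h1 k) h
    _ = ∑ c ∈ T, ∑' k : Fin d → ℤ,
          eLpNorm h ∞ (volume.restrict (Metric.ball (latticePoint k + c) (1 / 2))) :=
        Summable.tsum_finsetSum fun _ _ => ENNReal.summable
    _ < ∞ := ENNReal.sum_lt_top.2 fun c _ => tsum_eLpNorm_ball_lt_top hh c

theorem sq_sum_mul_le_sum_mul_sum {ι : Type*} (S : Finset ι) {x e : ι → ℝ≥0∞}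
    (hx : ∀ i, x i ≠ ∞) (he : ∀ i, e i ≠ ∞) :
    (∑ i ∈ S, x i * e i) ^ 2 ≤ (∑ i ∈ S, x i ^ 2 * e i) * ∑ i ∈ S, e i := by
  lift x to ι → ℝ≥0 using hx
  lift e to ι → ℝ≥0 using he
  have := Finset.sum_sq_le_sum_mul_sum_of_sq_le_mul S (r := fun i => x i * e i)
    (f := fun i => x i ^ 2 * e i) (g := e) (fun _ _ => zero_le) (fun _ _ => zero_le)
    (fun i _ => le_of_eq (by ring))
  beta_reduce
  exact_mod_cast this

/-- Young's inequality `ℓ² * ℓ¹ ⊆ ℓ²` on the lattice. -/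
theorem tsum_sq_sum_mul_le {d : ℕ} (S : Finset (Fin d → ℤ)) {x e : (Fin d → ℤ) → ℝ≥0∞}
    (hx : ∀ i, x i ≠ ∞) (he : ∑' k, e k ≠ ∞) :
    ∑' k, (∑ n ∈ S, x n * e (k - n)) ^ 2 ≤ (∑' k, e k) ^ 2 * ∑ n ∈ S, x n ^ 2 := by
  have he' : ∀ k, e k ≠ ∞ := fun k => ne_top_of_le_ne_top he (ENNReal.le_tsum k)
  calc ∑' k, (∑ n ∈ S, x n * e (k - n)) ^ 2
      ≤ ∑' k, (∑ n ∈ S, x n ^ 2 * e (k - n)) * ∑' m, e m := by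
        refine ENNReal.tsum_le_tsum fun k => ?_
        refine (sq_sum_mul_le_sum_mul_sum S hx fun n => he' (k - n)).trans ?_
        gcongr
        rw [← (Equiv.subLeft k).tsum_eq e]
        exact ENNReal.sum_le_tsum S
    _ = (∑ n ∈ S, x n ^ 2 * ∑' m, e m) * ∑' m, e m := by
        rw [ENNReal.tsum_mul_right, Summable.tsum_finsetSum fun _ _ => ENNReal.summable]
        congr 1
        refine Finset.sum_congr rfl fun n _ => ?_
        rw [ENNReal.tsum_mul_left]
        congr 1
        exact (Equiv.subRight n).tsum_eq e
    _ = _ := by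
        rw [← Finset.sum_mul]
        ring

theorem WienerCondition.exists_amalgamNormSq_le {d : ℕ} {h : L2 d} (hh : WienerCondition h) :
    ∃ C : ℝ≥0, ∀ a : (Fin d → ℤ) →₀ ℂ, amalgamNormSq (latticeSumL2 a h) ≤ C * coeffNormSq a := by
  have hfin := tsum_eLpNorm_window_lt_top hh
  set e : (Fin d → ℤ) → ℝ≥0∞ := fun k => eLpNorm h ∞ (volume.restrict (window k)) with he
  refine ⟨(∑' k, e k).toNNReal ^ 2, fun a => ?_⟩
  rw [amalgamNormSq_congr_ae (coeFn_latticeSumL2 a h), ENNReal.coe_pow,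
    ENNReal.coe_toNNReal hfin.ne]
  refine le_trans (ENNReal.tsum_le_tsum fun k => ?_)
    (tsum_sq_sum_mul_le a.support (x := fun n => ‖a n‖ₑ) (fun n => enorm_ne_top) hfin.ne)
  gcongr
  have hm : ∀ n : Fin d → ℤ, AEStronglyMeasurable (fun x => h (x - latticePoint n)) volume :=
    fun n => (Lp.memLp h).1.comp_measurePreserving (measurePreserving_sub_right volume _)
  have h1 : latticeSum a h =
      ∑ n ∈ a.support, a n • fun x => h (x - latticePoint n) := by
    ext x
    simp [latticeSum]
  rw [h1]
  refine (eLpNorm_sum_le (fun n _ => ((hm n).const_smul (a n)).restrict) le_top).trans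
    (Finset.sum_le_sum fun n _ => ?_)
  rw [eLpNorm_const_smul, window, eLpNorm_top_comp_sub (Lp.memLp h).1, ← latticePoint_sub]
  rfl

theorem RegularityCondition.exists_amalgamNormSq_le {d : ℕ} {h : L2 d}
    (hh : RegularityCondition h) :
    ∃ C : ℝ≥0, ∀ a : (Fin d → ℤ) →₀ ℂ, amalgamNormSq (latticeSumL2 a h) ≤ C * coeffNormSq a :=
  hh.elim (fun h => h.exists_amalgamNormSq_le) fun h => h.exists_amalgamNormSq_le

/-! ### Weak derivatives and local Lipschitz bounds -/

theorem IsWeakPartialDeriv.integral_fderiv_smul {d : ℕ} {j : Fin d} {f ψ : L2 d}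
    (h : IsWeakPartialDeriv j f ψ) {ρ : Rd d → ℝ} (hρ : ContDiff ℝ (⊤ : ℕ∞) ρ)
    (hc : HasCompactSupport ρ) (x : Rd d) :
    ∫ t, (fderiv ℝ ρ t (EuclideanSpace.single j 1)) • f (x - t) = ∫ t, ρ t • ψ (x - t) := by
  have hd : Differentiable ℝ ρ := hρ.differentiable (by simp)
  let η : Rd d → ℂ := fun y => ((ρ (x - y) : ℝ) : ℂ)
  have hη : ContDiff ℝ (⊤ : ℕ∞) η :=
    Complex.ofRealCLM.contDiff.comp (hρ.comp (contDiff_const.sub contDiff_id))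
  have hηc : HasCompactSupport η :=
    (hc.comp_homeomorph (Homeomorph.subLeft x)).comp_left (g := fun r : ℝ => (r : ℂ))
      Complex.ofReal_zero
  have hηd : ∀ y, fderiv ℝ η y (EuclideanSpace.single j 1) =
      -((fderiv ℝ ρ (x - y) (EuclideanSpace.single j 1) : ℝ) : ℂ) := by
    intro y
    have h1 : HasFDerivAt (fun y : Rd d => x - y) (-ContinuousLinearMap.id ℝ (Rd d)) y :=
      (hasFDerivAt_id y).const_sub x
    have h2 := Complex.ofRealCLM.hasFDerivAt.comp y ((hd (x - y)).hasFDerivAt.comp y h1)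
    have h3 : fderiv ℝ η y = _ := h2.fderiv
    rw [h3]
    simp
  have key := h η hη hηc
  rw [← integral_sub_left_eq_self _ volume x,
    ← integral_sub_left_eq_self (fun t => ρ t • ψ (x - t)) volume x]
  simp only [sub_sub_cancel, Complex.real_smul]
  simp only [hηd, mul_neg, integral_neg, neg_inj, η] at key
  simp only [mul_comm (Complex.ofReal _)]
  exact key

/-- Mollification commutes with weak derivatives. -/
theorem IsWeakPartialDeriv.hasFDerivAt_convolution {d : ℕ} {f : L2 d} {ψ : Fin d → L2 d}
    (h : ∀ j, IsWeakPartialDeriv j f (ψ j)) (b : ContDiffBump (0 : Rd d)) (x : Rd d) :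
    ∃ D : Rd d →L[ℝ] ℂ,
      HasFDerivAt (convolution (b.normed volume) f (ContinuousLinearMap.lsmul ℝ ℝ) volume) D x ∧
      ∀ j, D (EuclideanSpace.single j 1) = ∫ t, b.normed volume t • ψ j (x - t) := by
  have hli : LocallyIntegrable f volume := (Lp.memLp f).locallyIntegrable one_le_two
  have hcs : HasCompactSupport (b.normed volume) := b.hasCompactSupport_normed
  have hcd : ContDiff ℝ (⊤ : ℕ∞) (b.normed volume) := b.contDiff_normed
  refine ⟨_, hcs.hasFDerivAt_convolution_left _ (hcd.of_le (by exact_mod_cast le_top)) hli x,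
    fun j => ?_⟩
  rw [← (h j).integral_fderiv_smul hcd hcs x, convolution]
  have hex := (hcs.fderiv (𝕜 := ℝ)).convolutionExists_left
    ((ContinuousLinearMap.lsmul ℝ ℝ).precompL (Rd d) : _ →L[ℝ] ℂ →L[ℝ] (Rd d →L[ℝ] ℂ))
    (hcd.continuous_fderiv (by simp)) hli x
  rw [ContinuousLinearMap.integral_apply hex]
  rfl

theorem norm_le_sum_norm_apply_single {d : ℕ} (D : Rd d →L[ℝ] ℂ) :
    ‖D‖ ≤ ∑ j, ‖D (EuclideanSpace.single j 1)‖ := by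
  refine D.opNorm_le_bound (Finset.sum_nonneg fun _ _ => norm_nonneg _) fun v => ?_
  have hv : v = ∑ j, v j • (EuclideanSpace.single j (1 : ℝ) : Rd d) := by
    have := (EuclideanSpace.basisFun (Fin d) ℝ).sum_repr v
    simpa using this.symm
  calc ‖D v‖ = ‖∑ j, v j • D (EuclideanSpace.single j 1)‖ := by
        conv_lhs => rw [hv]
        rw [map_sum]
        simp only [map_smul]
    _ ≤ ∑ j, ‖D (EuclideanSpace.single j 1)‖ * ‖v‖ := by
        refine norm_sum_le_of_le _ fun j _ => ?_
        rw [norm_smul, mul_comm]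
        exact mul_le_mul_of_nonneg_left (PiLp.norm_apply_le v j) (norm_nonneg _)
    _ = _ := (Finset.sum_mul _ _ _).symm

theorem norm_integral_normed_smul_le {d : ℕ} (b : ContDiffBump (0 : Rd d)) {ψ : Rd d → ℂ}
    {P : Set (Rd d)} (hP : MeasurableSet P) {M : ℝ}
    (hM : ∀ᵐ x ∂volume.restrict P, ‖ψ x‖ ≤ M) {x : Rd d} (hx : Metric.ball x b.rOut ⊆ P) :
    ‖∫ t, b.normed volume t • ψ (x - t)‖ ≤ M := by
  rw [ae_restrict_iff' hP] at hM
  have h1 : ∀ᵐ t : Rd d, x - t ∈ P → ‖ψ (x - t)‖ ≤ M :=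
    (Measure.measurePreserving_sub_left volume x).quasiMeasurePreserving.ae hM
  calc ‖∫ t, b.normed volume t • ψ (x - t)‖ ≤ ∫ t, b.normed volume t * M := by
        refine norm_integral_le_of_norm_le (b.integrable_normed.mul_const M) ?_
        filter_upwards [h1] with t ht
        rw [norm_smul, Real.norm_of_nonneg (b.nonneg_normed t)]
        by_cases hb : t ∈ Metric.ball (0 : Rd d) b.rOut
        · refine mul_le_mul_of_nonneg_left (ht (hx ?_)) (b.nonneg_normed t)
          simpa [dist_eq_norm] using hb
        · have h0 : b.normed volume t = 0 := by
            rw [← Function.notMem_support, b.support_normed_eq]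
            exact hb
          simp [h0]
    _ = M := by rw [integral_mul_const, b.integral_normed, one_mul]

/-- If the weak derivatives of `f` are bounded on an open convex set, `f` satisfies the
corresponding Lipschitz bound there outside a null set. The null set, the complement of the set of
points at which a fixed sequence of mollifications converges, does not depend on the convex set. -/
theorem exists_full_measure_lipschitz {d : ℕ} {f : L2 d} {ψ : Fin d → L2 d}
    (h : ∀ j, IsWeakPartialDeriv j f (ψ j)) :
    ∃ E : Set (Rd d), (∀ᵐ x, x ∈ E) ∧ ∀ (P : Set (Rd d)), IsOpen P → Convex ℝ P →
      ∀ M : Fin d → ℝ, (∀ j, ∀ᵐ x ∂volume.restrict P, ‖ψ j x‖ ≤ M j) →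
        ∀ x ∈ E ∩ P, ∀ y ∈ E ∩ P, ‖f x - f y‖ ≤ (∑ j, M j) * ‖x - y‖ := by
  let b : ℕ → ContDiffBump (0 : Rd d) := fun n =>
    { rIn := 1 / (n + 1) / 2
      rOut := 1 / (n + 1)
      rIn_pos := by positivity
      rIn_lt_rOut := half_lt_self (by positivity) }
  have hb0 : Filter.Tendsto (fun n => (b n).rOut) Filter.atTop (nhds 0) :=
    tendsto_one_div_add_atTop_nhds_zero_nat
  let F : ℕ → Rd d → ℂ := fun n =>
    convolution ((b n).normed volume) f (ContinuousLinearMap.lsmul ℝ ℝ) volume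
  refine ⟨{x | Filter.Tendsto (fun n => F n x) Filter.atTop (nhds (f x))}, ?_, ?_⟩
  · refine ContDiffBump.ae_convolution_tendsto_right_of_locallyIntegrable (K := 2) hb0
      (Filter.Eventually.of_forall fun n => ?_)
      ((Lp.memLp f).locallyIntegrable one_le_two)
    change (1 : ℝ) / (n + 1) ≤ 2 * (1 / (n + 1) / 2)
    linarith
  intro P hPo hPc M hM x hx y hy
  have hseg : segment ℝ x y ⊆ P := hPc.segment_subset hx.2 hy.2
  have hcomp : IsCompact (segment ℝ x y) := by
    rw [segment_eq_image_lineMap]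
    exact isCompact_Icc.image AffineMap.lineMap_continuous
  obtain ⟨δ, hδ, hthick⟩ := hcomp.exists_thickening_subset_open hPo hseg
  have hev : ∀ᶠ n in Filter.atTop, ‖F n x - F n y‖ ≤ (∑ j, M j) * ‖x - y‖ := by
    filter_upwards [hb0.eventually (gt_mem_nhds hδ)] with n hn
    choose D hD hDj using fun z => IsWeakPartialDeriv.hasFDerivAt_convolution h (b n) z
    refine Convex.norm_image_sub_le_of_norm_hasFDerivWithin_le (𝕜 := ℝ) (s := segment ℝ x y)
      (f' := D) (fun z _ => (hD z).hasFDerivWithinAt) (fun z hz => ?_) (convex_segment x y)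
      (right_mem_segment ℝ x y) (left_mem_segment ℝ x y)
    refine (norm_le_sum_norm_apply_single _).trans (Finset.sum_le_sum fun j _ => ?_)
    rw [hDj]
    refine norm_integral_normed_smul_le (b n) hPo.measurableSet (hM j) ?_
    refine subset_trans (fun w hw => ?_) hthick
    exact Metric.mem_thickening_iff.2 ⟨z, hz, (Metric.mem_ball.1 hw).trans hn⟩
  exact le_of_tendsto ((hx.1.sub hy.1).norm) hev

/-- The local Lipschitz bound of `exists_full_measure_lipschitz` for a continuous
representative. -/
theorem norm_sub_le_of_weakPartialDeriv_le {d : ℕ} {f : L2 d} {ψ : Fin d → L2 d}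
    (h : ∀ j, IsWeakPartialDeriv j f (ψ j)) {g : Rd d → ℂ} (hg : Continuous g)
    (hfg : f =ᵐ[volume] g) {P : Set (Rd d)} (hPo : IsOpen P) (hPc : Convex ℝ P) {M : Fin d → ℝ}
    (hM : ∀ j, ∀ᵐ x ∂volume.restrict P, ‖ψ j x‖ ≤ M j) {x y : Rd d} (hx : x ∈ P) (hy : y ∈ P) :
    ‖g x - g y‖ ≤ (∑ j, M j) * ‖x - y‖ := by
  obtain ⟨E, hE, hL⟩ := exists_full_measure_lipschitz h
  have hdense : Dense {z | z ∈ E ∧ f z = g z} :=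
    Measure.dense_of_ae (hE.and hfg)
  have hcl := hdense.open_subset_closure_inter hPo
  have h1 : ∀ u ∈ P ∩ {z | z ∈ E ∧ f z = g z}, ∀ w ∈ P ∩ {z | z ∈ E ∧ f z = g z},
      ‖g u - g w‖ ≤ (∑ j, M j) * ‖u - w‖ := by
    rintro u ⟨hu, huE, hug⟩ w ⟨hw, hwE, hwg⟩
    rw [← hug, ← hwg]
    exact hL P hPo hPc M hM u ⟨huE, hu⟩ w ⟨hwE, hw⟩
  have h2 : ∀ u ∈ P, ∀ w ∈ P ∩ {z | z ∈ E ∧ f z = g z},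
      ‖g u - g w‖ ≤ (∑ j, M j) * ‖u - w‖ := by
    intro u hu w hw
    have hclosed : IsClosed {u | ‖g u - g w‖ ≤ (∑ j, M j) * ‖u - w‖} :=
      isClosed_le (by fun_prop) (by fun_prop)
    exact closure_minimal (fun v hv => h1 v hv w hw) hclosed (hcl hu)
  have hclosed : IsClosed {w | ‖g x - g w‖ ≤ (∑ j, M j) * ‖x - w‖} :=
    isClosed_le (by fun_prop) (by fun_prop)
  exact closure_minimal (fun w hw => h2 x hx w hw) hclosed (hcl hy)

/-- A function with bounded weak derivatives has a continuous representative. -/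
theorem exists_continuous_of_weakPartialDeriv_le {d : ℕ} {f : L2 d} {ψ : Fin d → L2 d}
    (h : ∀ j, IsWeakPartialDeriv j f (ψ j)) {M : Fin d → ℝ} (hM : ∀ j, ∀ᵐ x, ‖ψ j x‖ ≤ M j) :
    ∃ g : Rd d → ℂ, Continuous g ∧ f =ᵐ[volume] g := by
  obtain ⟨E, hE, hL⟩ := exists_full_measure_lipschitz h
  have hlip : LipschitzOnWith (∑ j, M j).toNNReal f E := by
    refine LipschitzOnWith.of_dist_le_mul fun x hx y hy => ?_
    rw [dist_eq_norm, dist_eq_norm]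
    refine (hL Set.univ isOpen_univ convex_univ M (fun j => ae_restrict_of_ae (hM j))
      x ⟨hx, trivial⟩ y ⟨hy, trivial⟩).trans ?_
    gcongr
    exact Real.le_coe_toNNReal _
  obtain ⟨g, hg, hgE⟩ := hlip.extend_finite_dimension
  exact ⟨g, hg.continuous, hE.mono fun x hx => hgE hx⟩

theorem integrable_mul_of_hasCompactSupport {d : ℕ} (f : L2 d) {η : Rd d → ℂ}
    (hη : Continuous η) (hc : HasCompactSupport η) : Integrable fun x => f x * η x :=
  (Lp.memLp f).integrable_mul (q := 2) (hη.memLp_of_hasCompactSupport hc)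

theorem IsWeakPartialDeriv.latticeSumL2 {d : ℕ} {j : Fin d} {f ψ : L2 d}
    (h : IsWeakPartialDeriv j f ψ) (a : (Fin d → ℤ) →₀ ℂ) :
    IsWeakPartialDeriv j (latticeSumL2 a f) (latticeSumL2 a ψ) := by
  intro η hη hηc
  have hsum : ∀ (u : L2 d) (ζ : Rd d → ℂ), Continuous ζ → HasCompactSupport ζ →
      ∫ x, (_root_.latticeSumL2 a u : L2 d) x * ζ x =
        ∑ n ∈ a.support, a n * ∫ x, u x * ζ (x + latticePoint n) := by
    intro u ζ hζ hζc
    have h1 : ∀ n, Integrable fun x => a n * (u (x - latticePoint n) * ζ x) := by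
      intro n
      refine ((integrable_mul_of_hasCompactSupport (translateL2 (latticePoint n) u) hζ
        hζc).congr ?_).const_mul _
      filter_upwards [coeFn_translateL2 (latticePoint n) u] with x hx
      rw [hx]
    calc ∫ x, (_root_.latticeSumL2 a u : L2 d) x * ζ x
        = ∫ x, ∑ n ∈ a.support, a n * (u (x - latticePoint n) * ζ x) := by
          refine integral_congr_ae ?_
          filter_upwards [coeFn_latticeSumL2 a u] with x hx
          rw [hx, latticeSum, Finset.sum_mul]
          exact Finset.sum_congr rfl fun n _ => mul_assoc _ _ _
      _ = ∑ n ∈ a.support, a n * ∫ x, u (x - latticePoint n) * ζ x := by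
          rw [integral_finsetSum _ fun n _ => h1 n]
          exact Finset.sum_congr rfl fun n _ => integral_const_mul _ _
      _ = _ := by
          refine Finset.sum_congr rfl fun n _ => ?_
          rw [← integral_add_right_eq_self (fun x => u (x - latticePoint n) * ζ x)
            (latticePoint n)]
          simp only [add_sub_cancel_right]
  have hd1 : Continuous fun x => fderiv ℝ η x (EuclideanSpace.single j 1) :=
    (hη.continuous_fderiv (by simp)).clm_apply continuous_const
  have hd2 : HasCompactSupport fun x => fderiv ℝ η x (EuclideanSpace.single j 1) :=
    (hηc.fderiv (𝕜 := ℝ)).comp_left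
      (g := fun D : Rd d →L[ℝ] ℂ => D (EuclideanSpace.single j 1)) (by simp)
  rw [hsum f _ hd1 hd2, hsum ψ η hη.continuous hηc, ← Finset.sum_neg_distrib]
  refine Finset.sum_congr rfl fun n _ => ?_
  have h2 := h (fun x => η (x + latticePoint n)) (hη.comp (contDiff_id.add contDiff_const))
    (hηc.comp_homeomorph (Homeomorph.addRight (latticePoint n)))
  simp only [fderiv_comp_add_right] at h2
  rw [h2, mul_neg]

/-! ### Deformation bounds for finite sums of integer translates -/

theorem norm_sub_latticePoint_le {d : ℕ} {k : Fin d → ℤ} {x : Rd d} (hx : x ∈ cell k) :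
    ‖x - latticePoint k‖ ≤ d := by
  rw [EuclideanSpace.norm_eq]
  refine Real.sqrt_le_iff.2 ⟨by positivity, ?_⟩
  calc ∑ i, ‖(x - latticePoint k) i‖ ^ 2 ≤ ∑ _i : Fin d, (1 : ℝ) := by
        refine Finset.sum_le_sum fun i _ => ?_
        rw [PiLp.sub_apply, latticePoint_apply, Real.norm_eq_abs, sq_abs]
        have := hx i
        nlinarith [this.1, this.2]
    _ = d := by simp
    _ ≤ (d : ℝ) ^ 2 := by exact_mod_cast Nat.le_self_pow two_ne_zero d

theorem mem_window_of_mem_cell {d : ℕ} {k : Fin d → ℤ} {x y : Rd d} (hx : x ∈ cell k)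
    (hxy : ‖y - x‖ ≤ 1) : y ∈ window k := by
  rw [window, Metric.mem_ball, dist_eq_norm]
  have h1 := norm_sub_latticePoint_le hx
  have h2 : y - latticePoint k = (y - x) + (x - latticePoint k) := by abel
  rw [h2]
  linarith [norm_add_le (y - x) (x - latticePoint k)]

theorem cell_subset_window {d : ℕ} (k : Fin d → ℤ) : (cell k : Set (Rd d)) ⊆ window k :=
  fun _ hx => mem_window_of_mem_cell hx (by simp)

theorem exists_mem_cell {d : ℕ} (x : Rd d) : ∃ k : Fin d → ℤ, x ∈ cell k :=
  ⟨_, mem_cell_iff.2 rfl⟩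

theorem enorm_le_of_continuous {d : ℕ} {g : Rd d → ℂ} (hg : Continuous g) {P : Set (Rd d)}
    (hP : IsOpen P) {x : Rd d} (hx : x ∈ P) :
    ‖g x‖ₑ ≤ eLpNorm g ∞ (volume.restrict P) := by
  by_contra hlt
  rw [not_le] at hlt
  set M := eLpNorm g ∞ (volume.restrict P) with hM
  have hopen : IsOpen (P ∩ {y | M < ‖g y‖ₑ}) := hP.inter (isOpen_lt continuous_const hg.enorm)
  have h0 : volume (P ∩ {y | M < ‖g y‖ₑ}) = 0 := by
    have h1 : ∀ᵐ y ∂volume.restrict P, ‖g y‖ₑ ≤ M := by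
      rw [hM, eLpNorm_exponent_top]
      exact ae_le_eLpNormEssSup
    rw [ae_restrict_iff' hP.measurableSet] at h1
    refine measure_mono_null (fun y hy => ?_) (ae_iff.1 h1)
    rw [Set.mem_ofPred_eq]
    exact fun hle => (hle hy.1).not_gt hy.2
  have h2 := (hopen.measure_eq_zero_iff volume).1 h0
  exact Set.notMem_empty x (h2 ▸ ⟨hx, hlt⟩)

theorem exists_ae_norm_le_of_amalgamNormSq_lt_top {d : ℕ} {f : Rd d → ℂ}
    (hf : amalgamNormSq f < ∞) : ∃ M : ℝ, ∀ᵐ x, ‖f x‖ ≤ M := by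
  refine ⟨Real.sqrt (amalgamNormSq f).toReal, ?_⟩
  have h1 : ∀ k : Fin d → ℤ, ∀ᵐ x : Rd d, x ∈ window k → ‖f x‖ₑ ^ 2 ≤ amalgamNormSq f := by
    intro k
    rw [← ae_restrict_iff' (measurableSet_window k)]
    filter_upwards [ae_le_eLpNormEssSup (f := f) (μ := volume.restrict (window k))] with x hx
    rw [← eLpNorm_exponent_top] at hx
    exact (pow_le_pow_left₀ zero_le hx 2).trans (ENNReal.le_tsum k)
  filter_upwards [ae_all_iff.2 h1] with x hx
  obtain ⟨k, hk⟩ := exists_mem_cell x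
  refine Real.le_sqrt_of_sq_le ?_
  have := ENNReal.toReal_mono hf.ne (hx k (cell_subset_window k hk))
  simpa using this

theorem setLIntegral_cell_le {d : ℕ} {k : Fin d → ℤ} {F : Rd d → ℝ≥0∞} {c : ℝ≥0∞}
    (h : ∀ᵐ x, x ∈ cell k → F x ≤ c) : ∫⁻ x in cell k, F x ≤ c := by
  refine (setLIntegral_mono_ae' (measurableSet_cell k) (g := fun _ => c) h).trans ?_
  rw [setLIntegral_const, volume_cell, mul_one]

/-- Displacements of size `r ≤ 1`: on each cell the difference is at most `r` times the Lipschitz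
constant on the surrounding window. -/
theorem lintegral_deform_sub_sq_le {d : ℕ} {f : L2 d} {ψ : Fin d → L2 d}
    (h : ∀ j, IsWeakPartialDeriv j f (ψ j)) {g : Rd d → ℂ} (hg : Continuous g)
    (hfg : f =ᵐ[volume] g) (hψ : ∀ j, amalgamNormSq (ψ j) < ∞) {r : ℝ} (hr : r ≤ 1)
    {σ : Rd d → Rd d} (hσ : ∀ᵐ y, ‖σ y‖ ≤ r) :
    ∫⁻ y, ‖deform σ g y - g y‖ₑ ^ 2 ≤
      ENNReal.ofReal r ^ 2 * (d * ∑ j, amalgamNormSq (ψ j)) := by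
  set e : Fin d → (Fin d → ℤ) → ℝ≥0∞ := fun j k =>
    eLpNorm (ψ j) ∞ (volume.restrict (window k)) with he
  have hfin : ∀ j k, e j k ≠ ∞ := by
    intro j k htop
    have h1 : e j k ^ 2 ≤ amalgamNormSq (ψ j) :=
      ENNReal.le_tsum (f := fun k => eLpNorm (ψ j) ∞ (volume.restrict (window k)) ^ 2) k
    rw [htop] at h1
    simp only [ne_eq, OfNat.ofNat_ne_zero, not_false_eq_true, ENNReal.top_pow,
      top_le_iff] at h1
    exact (hψ j).ne h1
  have hM : ∀ k j, ∀ᵐ x ∂volume.restrict (window k), ‖ψ j x‖ ≤ (e j k).toReal := by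
    intro k j
    filter_upwards [ae_le_eLpNormEssSup (f := ψ j) (μ := volume.restrict (window k))] with x hx
    rw [← eLpNorm_exponent_top] at hx
    have := ENNReal.toReal_mono (hfin j k) hx
    simpa using this
  have hcell : ∀ k : Fin d → ℤ, ∫⁻ y in cell k, ‖deform σ g y - g y‖ₑ ^ 2 ≤
      ENNReal.ofReal r ^ 2 * (d * ∑ j, e j k ^ 2) := by
    intro k
    refine setLIntegral_cell_le ?_
    filter_upwards [hσ] with y hy hyk
    have h1 : y - σ y ∈ window k := mem_window_of_mem_cell hyk (by simpa using hy.trans hr)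
    have h2 := norm_sub_le_of_weakPartialDeriv_le h hg hfg Metric.isOpen_ball
      (convex_ball _ _) (hM k) h1 (cell_subset_window k hyk)
    have h3 : ‖deform σ g y - g y‖ₑ ≤ ENNReal.ofReal r * ∑ j, e j k := by
      have h4 : ∑ j, e j k = ENNReal.ofReal (∑ j, (e j k).toReal) := by
        rw [ENNReal.ofReal_sum_of_nonneg fun _ _ => ENNReal.toReal_nonneg]
        exact Finset.sum_congr rfl fun j _ => (ENNReal.ofReal_toReal (hfin j k)).symm
      rw [h4, mul_comm, ← ENNReal.ofReal_mul (Finset.sum_nonneg fun _ _ => ENNReal.toReal_nonneg),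
        ← ofReal_norm]
      refine ENNReal.ofReal_le_ofReal (h2.trans ?_)
      refine mul_le_mul_of_nonneg_left ?_ (Finset.sum_nonneg fun _ _ => ENNReal.toReal_nonneg)
      simpa using hy
    have h5 := sq_sum_mul_le_sum_mul_sum Finset.univ (x := fun j => e j k) (e := fun _ => 1)
      (fun j => hfin j k) (fun _ => ENNReal.one_ne_top)
    simp only [mul_one, Finset.sum_const, Finset.card_univ, Fintype.card_fin, nsmul_eq_mul] at h5
    calc ‖deform σ g y - g y‖ₑ ^ 2 ≤ (ENNReal.ofReal r * ∑ j, e j k) ^ 2 := by gcongr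
      _ = ENNReal.ofReal r ^ 2 * (∑ j, e j k) ^ 2 := mul_pow _ _ _
      _ ≤ ENNReal.ofReal r ^ 2 * (d * ∑ j, e j k ^ 2) := by
          gcongr
          rw [mul_comm]
          exact h5
  calc ∫⁻ y, ‖deform σ g y - g y‖ₑ ^ 2
      = ∑' k : Fin d → ℤ, ∫⁻ y in cell k, ‖deform σ g y - g y‖ₑ ^ 2 := lintegral_eq_tsum_cell _
    _ ≤ ∑' k : Fin d → ℤ, ENNReal.ofReal r ^ 2 * (d * ∑ j, e j k ^ 2) :=
        ENNReal.tsum_le_tsum hcell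
    _ = _ := by
        rw [ENNReal.tsum_mul_left, ENNReal.tsum_mul_left,
          Summable.tsum_finsetSum fun _ _ => ENNReal.summable]
        rfl

/-- Displacements of size `r ≥ 1`: the displaced point lies in one of the `O(r^d)` cells around
the cell of the point itself. -/
theorem lintegral_deform_sub_sq_le_of_one_le {d : ℕ} {g : Rd d → ℂ} (hg : Continuous g)
    {r : ℝ} (hr : 1 ≤ r) {σ : Rd d → Rd d} (hσ : ∀ᵐ y, ‖σ y‖ ≤ r) :
    ∫⁻ y, ‖deform σ g y - g y‖ₑ ^ 2 ≤
      ENNReal.ofReal r ^ d * (4 * 7 ^ d * amalgamNormSq g) := by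
  set M : (Fin d → ℤ) → ℝ≥0∞ := fun k => eLpNorm g ∞ (volume.restrict (window k)) with hM
  have hgM : ∀ k, ∀ x ∈ cell k, ‖g x‖ₑ ≤ M k := fun k x hx =>
    enorm_le_of_continuous hg Metric.isOpen_ball (cell_subset_window k hx)
  let N : ℤ := ⌈r⌉ + 1
  let T : Finset (Fin d → ℤ) := Fintype.piFinset fun _ => Finset.Icc (-N) N
  have hN : r + 1 ≤ N := by
    have := Int.le_ceil r
    simp only [N]
    push_cast
    linarith
  have hN' : (N : ℝ) ≤ r + 2 := by
    have := Int.ceil_lt_add_one r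
    simp only [N]
    push_cast
    linarith
  have hcard : (T.card : ℝ≥0∞) ≤ ENNReal.ofReal r ^ d * 7 ^ d := by
    have h1 : (T.card : ℝ) ≤ (7 * r) ^ d := by
      have h2 : T.card = (2 * N + 1).toNat ^ d := by
        simp only [T, Fintype.card_piFinset, Int.card_Icc, Finset.prod_const, Finset.card_univ,
          Fintype.card_fin]
        congr 2
        ring
      rw [h2, Nat.cast_pow]
      refine pow_le_pow_left₀ (by positivity) ?_ d
      have h3 : (((2 * N + 1).toNat : ℤ) : ℝ) = 2 * N + 1 := by
        have hN0 : (0 : ℝ) ≤ N := by linarith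
        have : (0 : ℤ) ≤ 2 * N + 1 := by
          have : (0 : ℤ) ≤ N := by exact_mod_cast hN0
          omega
        rw [Int.toNat_of_nonneg this]
        push_cast
        ring
      have h4 : ((2 * N + 1).toNat : ℝ) = 2 * N + 1 := by exact_mod_cast h3
      rw [h4]
      linarith
    have h5 : ENNReal.ofReal (T.card : ℝ) ≤ ENNReal.ofReal ((7 * r) ^ d) :=
      ENNReal.ofReal_le_ofReal h1
    rw [ENNReal.ofReal_natCast, mul_pow, ENNReal.ofReal_mul (by positivity),
      ENNReal.ofReal_pow (by norm_num), ENNReal.ofReal_pow (by linarith), mul_comm] at h5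
    simpa using h5
  have hcell : ∀ k : Fin d → ℤ, ∫⁻ y in cell k, ‖deform σ g y - g y‖ₑ ^ 2 ≤
      4 * ∑ t ∈ T, M (k + t) ^ 2 := by
    intro k
    refine setLIntegral_cell_le ?_
    filter_upwards [hσ] with y hy hyk
    have hz : ∀ z : Rd d, ‖z - y‖ ≤ r → ‖g z‖ₑ ^ 2 ≤ ∑ t ∈ T, M (k + t) ^ 2 := by
      intro z hzy
      obtain ⟨m, hm⟩ := exists_mem_cell z
      have hmT : m - k ∈ T := by
        refine Fintype.mem_piFinset.2 fun i => Finset.mem_Icc.2 ?_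
        have h1 := (PiLp.norm_apply_le (z - y) i).trans hzy
        rw [PiLp.sub_apply, Real.norm_eq_abs, abs_le] at h1
        have h2 := hm i
        have h3 := hyk i
        simp only [Set.mem_Ioc] at h2 h3
        constructor
        · have : (-(N : ℝ)) ≤ (m i : ℝ) - k i := by linarith
          rw [Pi.sub_apply]
          exact_mod_cast this
        · have : (m i : ℝ) - k i ≤ N := by linarith
          rw [Pi.sub_apply]
          exact_mod_cast this
      calc ‖g z‖ₑ ^ 2 ≤ M (k + (m - k)) ^ 2 := by
            rw [add_sub_cancel]
            gcongr
            exact hgM m z hm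
        _ ≤ _ := Finset.single_le_sum (f := fun t => M (k + t) ^ 2) (fun _ _ => zero_le) hmT
    have h1 := hz (y - σ y) (by simpa using hy)
    have h2 := hz y (by simp; linarith)
    have h3 : ‖deform σ g y - g y‖ₑ ≤ ‖g (y - σ y)‖ₑ + ‖g y‖ₑ := enorm_sub_le
    have h4 : ∀ a b s : ℝ≥0∞, a ^ 2 ≤ s → b ^ 2 ≤ s → (a + b) ^ 2 ≤ 4 * s := by
      intro a b s ha hb
      have h5 : ∀ a b : ℝ≥0∞, a ≤ b → (a + b) ^ 2 ≤ 4 * b ^ 2 := by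
        intro a b hab
        calc (a + b) ^ 2 ≤ (b + b) ^ 2 := by gcongr
          _ = 4 * b ^ 2 := by ring
      rcases le_total a b with hab | hab
      · exact (h5 a b hab).trans (by gcongr)
      · rw [add_comm]
        exact (h5 b a hab).trans (by gcongr)
    exact (pow_le_pow_left₀ zero_le h3 2).trans (h4 _ _ _ h1 h2)
  calc ∫⁻ y, ‖deform σ g y - g y‖ₑ ^ 2
      = ∑' k : Fin d → ℤ, ∫⁻ y in cell k, ‖deform σ g y - g y‖ₑ ^ 2 := lintegral_eq_tsum_cell _
    _ ≤ ∑' k : Fin d → ℤ, 4 * ∑ t ∈ T, M (k + t) ^ 2 := ENNReal.tsum_le_tsum hcell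
    _ = 4 * ∑ t ∈ T, ∑' k : Fin d → ℤ, M k ^ 2 := by
        rw [ENNReal.tsum_mul_left, Summable.tsum_finsetSum fun _ _ => ENNReal.summable]
        congr 1
        exact Finset.sum_congr rfl fun t _ => (Equiv.addRight t).tsum_eq fun k => M k ^ 2
    _ = 4 * (T.card * amalgamNormSq g) := by
        rw [Finset.sum_const, nsmul_eq_mul]
        rfl
    _ ≤ 4 * (ENNReal.ofReal r ^ d * 7 ^ d * amalgamNormSq g) := by gcongr
    _ = _ := by ring

/-- The estimates at scale `1`, for finite sums of integer translates of a continuous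
representative `φ₀` of `φ`. -/
theorem exists_latticeSum_deform_le {d : ℕ} {φ : L2 d} (hRiesz : RieszCondition φ)
    (hReg : RegularityCondition φ) (hDeriv : DerivRegularityCondition φ) :
    ∃ φ₀ : Rd d → ℂ, Continuous φ₀ ∧ φ =ᵐ[volume] φ₀ ∧ ∃ C : ℝ≥0, ∀ a : (Fin d → ℤ) →₀ ℂ,
      (∀ x, ‖latticeSum a φ₀ x‖ₑ ^ 2 ≤ C * ‖latticeSumL2 a φ‖ₑ ^ 2) ∧
      ∀ (r : ℝ) (σ : Rd d → Rd d), (∀ᵐ y, ‖σ y‖ ≤ r) →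
        (r ≤ 1 → ∫⁻ y, ‖deform σ (latticeSum a φ₀) y - latticeSum a φ₀ y‖ₑ ^ 2 ≤
          ENNReal.ofReal r ^ 2 * (C * ‖latticeSumL2 a φ‖ₑ ^ 2)) ∧
        (1 ≤ r → ∫⁻ y, ‖deform σ (latticeSum a φ₀) y - latticeSum a φ₀ y‖ₑ ^ 2 ≤
          ENNReal.ofReal r ^ d * (C * ‖latticeSumL2 a φ‖ₑ ^ 2)) := by
  obtain ⟨C₁, hC₁⟩ := hRiesz.exists_coeffNormSq_le
  obtain ⟨C₂, hC₂⟩ := hReg.exists_amalgamNormSq_le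
  choose ψ hψ hψR using hDeriv
  choose C₃ hC₃ using fun j => (hψR j).exists_amalgamNormSq_le
  have hcoeff : ∀ a : (Fin d → ℤ) →₀ ℂ, coeffNormSq a < ∞ := fun a =>
    ENNReal.sum_lt_top.2 fun n _ => ENNReal.pow_lt_top enorm_lt_top
  have hfin : ∀ j (a : (Fin d → ℤ) →₀ ℂ), amalgamNormSq (latticeSumL2 a (ψ j)) < ∞ := fun j a =>
    (hC₃ j a).trans_lt (ENNReal.mul_lt_top ENNReal.coe_lt_top (hcoeff a))
  have hbdd : ∀ j, ∃ M : ℝ, ∀ᵐ x, ‖ψ j x‖ ≤ M := by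
    intro j
    have h1 : latticeSumL2 (Finsupp.single 0 1) (ψ j) =ᵐ[volume] ψ j := by
      refine (coeFn_latticeSumL2 _ _).trans (Filter.Eventually.of_forall fun x => ?_)
      have h0 : latticePoint (0 : Fin d → ℤ) = 0 := by ext i; simp [latticePoint_apply]
      simp [latticeSum, h0]
    have h2 := hfin j (Finsupp.single 0 1)
    rw [amalgamNormSq_congr_ae h1] at h2
    exact exists_ae_norm_le_of_amalgamNormSq_lt_top h2
  choose M hM using hbdd
  obtain ⟨φ₀, hφ₀, hφφ₀⟩ := exists_continuous_of_weakPartialDeriv_le hψ hM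
  refine ⟨φ₀, hφ₀, hφφ₀, C₂ * C₁ + d * (∑ j, C₃ j) * C₁ + 4 * 7 ^ d * (C₂ * C₁), fun a => ?_⟩
  set Q := ‖latticeSumL2 a φ‖ₑ ^ 2 with hQ
  have hG : Continuous (latticeSum a φ₀) := by
    unfold latticeSum
    fun_prop
  have hfG : latticeSumL2 a φ =ᵐ[volume] latticeSum a φ₀ :=
    (coeFn_latticeSumL2 a φ).trans (latticeSum_congr_ae a hφφ₀)
  have hA : amalgamNormSq (latticeSum a φ₀) ≤ C₂ * C₁ * Q := by
    rw [← amalgamNormSq_congr_ae hfG, mul_assoc]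
    exact (hC₂ a).trans (by gcongr; exact hC₁ a)
  have hA' : ∑ j, amalgamNormSq (latticeSumL2 a (ψ j)) ≤ (∑ j, (C₃ j : ℝ≥0∞)) * C₁ * Q := by
    rw [mul_assoc, Finset.sum_mul]
    exact Finset.sum_le_sum fun j _ => (hC₃ j a).trans (by gcongr; exact hC₁ a)
  push_cast
  refine ⟨fun x => ?_, fun r σ hσ => ⟨fun hr => ?_, fun hr => ?_⟩⟩
  · obtain ⟨k, hk⟩ := exists_mem_cell x
    calc ‖latticeSum a φ₀ x‖ₑ ^ 2
        ≤ eLpNorm (latticeSum a φ₀) ∞ (volume.restrict (window k)) ^ 2 := by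
          gcongr
          exact enorm_le_of_continuous hG Metric.isOpen_ball (cell_subset_window k hk)
      _ ≤ amalgamNormSq (latticeSum a φ₀) :=
          ENNReal.le_tsum (f := fun k =>
            eLpNorm (latticeSum a φ₀) ∞ (volume.restrict (window k)) ^ 2) k
      _ ≤ C₂ * C₁ * Q := hA
      _ ≤ _ := by
          gcongr
          rw [add_assoc]
          exact le_self_add
  · refine (lintegral_deform_sub_sq_le (fun j => (hψ j).latticeSumL2 a) hG hfG
      (fun j => hfin j a) hr hσ).trans ?_
    gcongr ENNReal.ofReal r ^ 2 * ?_
    calc (d : ℝ≥0∞) * ∑ j, amalgamNormSq (latticeSumL2 a (ψ j))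
        ≤ d * ((∑ j, (C₃ j : ℝ≥0∞)) * C₁ * Q) := by gcongr
      _ = d * (∑ j, (C₃ j : ℝ≥0∞)) * C₁ * Q := by ring
      _ ≤ _ := by
          gcongr
          rw [add_right_comm]
          exact le_add_self
  · refine (lintegral_deform_sub_sq_le_of_one_le hG hr hσ).trans ?_
    gcongr ENNReal.ofReal r ^ d * ?_
    calc (4 : ℝ≥0∞) * 7 ^ d * amalgamNormSq (latticeSum a φ₀)
        ≤ 4 * 7 ^ d * (C₂ * C₁ * Q) := by gcongr
      _ = 4 * 7 ^ d * (C₂ * C₁) * Q := by ring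
      _ ≤ _ := by
          gcongr
          exact le_add_self

/-! ### Dilation to the scale `s` -/

/-- The rate of the deformation bound for the squared norm: `r²` for `r ≤ 1` and `r^d` for
`r ≥ 1`. -/
noncomputable def deformRate (d : ℕ) (r : ℝ) : ℝ≥0∞ :=
  if r ≤ 1 then ENNReal.ofReal r ^ 2 else ENNReal.ofReal r ^ d

theorem deformRate_of_le_one {d : ℕ} {r : ℝ} (hr : r ≤ 1) :
    deformRate d r = ENNReal.ofReal r ^ 2 := if_pos hr

theorem deformRate_of_one_le {d : ℕ} {r : ℝ} (hr : 1 ≤ r) :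
    deformRate d r = ENNReal.ofReal r ^ d := by
  rcases hr.eq_or_lt with h | h
  · simp [deformRate, ← h]
  · exact if_neg h.not_ge

theorem deformRate_ne_top (d : ℕ) (r : ℝ) : deformRate d r ≠ ∞ := by
  unfold deformRate
  split_ifs <;> exact ENNReal.pow_ne_top ENNReal.ofReal_ne_top

/-- The normalizing factor `s^{-d/2}` of the dilation to scale `s`. -/
noncomputable def scaleFactor (d : ℕ) (s : ℝ) : ℂ := ((s ^ (-(d : ℝ) / 2) : ℝ) : ℂ)

theorem enorm_scaleFactor_sq (d : ℕ) {s : ℝ} (hs : 0 < s) :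
    ‖scaleFactor d s‖ₑ ^ 2 * ENNReal.ofReal (s ^ d) = 1 := by
  have h0 : 0 ≤ s ^ (-(d : ℝ) / 2) := Real.rpow_nonneg hs.le _
  rw [← ofReal_norm, scaleFactor, Complex.norm_real, Real.norm_of_nonneg h0,
    ← ENNReal.ofReal_pow h0, ← ENNReal.ofReal_mul (by positivity), ← Real.rpow_mul_natCast hs.le,
    ← Real.rpow_natCast s d, ← Real.rpow_add hs]
  have : -(d : ℝ) / 2 * ((2 : ℕ) : ℝ) + d = 0 := by push_cast; ring
  rw [this, Real.rpow_zero, ENNReal.ofReal_one]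

/-- The dilation `G ↦ s^{-d/2} G(·/s)` preserves the integral of the squared modulus. -/
theorem lintegral_scale {d : ℕ} {s : ℝ} (hs : 0 < s) (F : Rd d → ℝ≥0∞) :
    ∫⁻ x, ‖scaleFactor d s‖ₑ ^ 2 * F (s⁻¹ • x) = ∫⁻ x, F x := by
  have hne : s⁻¹ ≠ 0 := (inv_pos.2 hs).ne'
  have h1 : ∫⁻ x : Rd d, F (s⁻¹ • x) = ENNReal.ofReal (s ^ d) * ∫⁻ x, F x := by
    have hemb : MeasurableEmbedding fun x : Rd d => s⁻¹ • x :=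
      (Homeomorph.smulOfNeZero s⁻¹ hne).measurableEmbedding
    rw [← hemb.lintegral_map (μ := volume) F]
    have := Measure.map_addHaar_smul (volume : Measure (Rd d)) hne
    change ∫⁻ x, F x ∂Measure.map (s⁻¹ • ·) volume = _
    rw [this, lintegral_smul_measure, finrank_euclideanSpace, Fintype.card_fin, inv_pow, inv_inv,
      abs_of_pos (by positivity), smul_eq_mul]
  rw [lintegral_const_mul' _ _ (ENNReal.pow_ne_top enorm_ne_top), h1, ← mul_assoc,
    enorm_scaleFactor_sq d hs, one_mul]

theorem latticeSum_add {d : ℕ} (a b : (Fin d → ℤ) →₀ ℂ) (h : Rd d → ℂ) (x : Rd d) :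
    latticeSum (a + b) h x = latticeSum a h x + latticeSum b h x :=
  Finsupp.sum_add_index' (h := fun n c => c * h (x - latticePoint n)) (by simp)
    fun _ _ _ => add_mul _ _ _

theorem latticeSum_smul {d : ℕ} (c : ℂ) (a : (Fin d → ℤ) →₀ ℂ) (h : Rd d → ℂ) (x : Rd d) :
    latticeSum (c • a) h x = c * latticeSum a h x := by
  have := Finsupp.sum_smul_index' (g := a) (b := c)
    (h := fun n c => c * h (x - latticePoint n)) (by simp)
  refine Eq.trans this ?_
  simp only [smul_eq_mul, mul_assoc]
  exact (Finset.mul_sum _ _ _).symm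

/-- The span of the atoms at scale `s`, whose closure is the approximation space. -/
noncomputable def atomSpan {d : ℕ} (φ : L2 d) (s : ℝ) : Submodule ℂ (L2 d) :=
  Submodule.span ℂ {g : L2 d | ∃ n : Fin d → ℤ, (g : Rd d → ℂ) =ᵐ[volume] atomFun φ s n}

theorem exists_ae_eq_latticeSum {d : ℕ} {φ : L2 d} {φ₀ : Rd d → ℂ} (hφ : φ =ᵐ[volume] φ₀) {s : ℝ}
    (hs : 0 < s) {f : L2 d} (hf : f ∈ atomSpan φ s) :
    ∃ a : (Fin d → ℤ) →₀ ℂ,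
      f =ᵐ[volume] fun x => scaleFactor d s * latticeSum a φ₀ (s⁻¹ • x) := by
  have hne : s⁻¹ ≠ 0 := (inv_pos.2 hs).ne'
  induction hf using Submodule.span_induction with
  | mem g hg =>
    obtain ⟨n, hn⟩ := hg
    refine ⟨Finsupp.single n 1, ?_⟩
    have h1 : ∀ᵐ x : Rd d, φ (x - latticePoint n) = φ₀ (x - latticePoint n) :=
      (measurePreserving_sub_right volume (latticePoint n)).quasiMeasurePreserving.ae hφ
    filter_upwards [hn, ae_comp_smul hne h1] with x h2 h3
    rw [h2, atomFun, smul_sub, inv_smul_smul₀ hs.ne', h3]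
    simp [latticeSum, scaleFactor]
  | zero =>
    refine ⟨0, ?_⟩
    filter_upwards [Lp.coeFn_zero ℂ 2 (volume : Measure (Rd d))] with x hx
    rw [hx]
    simp [latticeSum]
  | add f g _ _ hf hg =>
    obtain ⟨a, ha⟩ := hf
    obtain ⟨b, hb⟩ := hg
    refine ⟨a + b, ?_⟩
    filter_upwards [Lp.coeFn_add f g, ha, hb] with x h1 h2 h3
    rw [h1, Pi.add_apply, h2, h3, latticeSum_add, mul_add]
  | smul c f _ hf =>
    obtain ⟨a, ha⟩ := hf
    refine ⟨c • a, ?_⟩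
    filter_upwards [Lp.coeFn_smul c f, ha] with x h1 h2
    rw [h1, Pi.smul_apply, h2, latticeSum_smul, smul_eq_mul, mul_left_comm]

theorem ae_norm_le_supNorm {d : ℕ} {τ : Rd d → Rd d} (hτ : MemLp τ ∞ volume) :
    ∀ᵐ x, ‖τ x‖ ≤ supNorm τ := by
  filter_upwards [ae_le_eLpNormEssSup (f := τ) (μ := (volume : Measure (Rd d)))] with x hx
  rw [← eLpNorm_exponent_top] at hx
  have := ENNReal.toReal_mono hτ.2.ne hx
  rwa [toReal_enorm] at this

/-- The estimates at scale `s` on the span of the atoms. -/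
theorem exists_atomSpan_deform_le {d : ℕ} {φ : L2 d} (hRiesz : RieszCondition φ)
    (hReg : RegularityCondition φ) (hDeriv : DerivRegularityCondition φ) :
    ∃ C : ℝ≥0, ∀ s : ℝ, 0 < s → ∀ f ∈ atomSpan φ s,
      ∃ g : Rd d → ℂ, Continuous g ∧ f =ᵐ[volume] g ∧
        (∀ x, ‖g x‖ₑ ^ 2 ≤ ‖scaleFactor d s‖ₑ ^ 2 * (C * ‖f‖ₑ ^ 2)) ∧
        ∀ τ : Rd d → Rd d, MemLp τ ∞ volume →
          ∫⁻ x, ‖deform τ g x - g x‖ₑ ^ 2 ≤ deformRate d (supNorm τ / s) * (C * ‖f‖ₑ ^ 2) := by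
  obtain ⟨φ₀, hφ₀, hφφ₀, C, hC⟩ := exists_latticeSum_deform_le hRiesz hReg hDeriv
  refine ⟨C, fun s hs f hf => ?_⟩
  obtain ⟨a, ha⟩ := exists_ae_eq_latticeSum hφφ₀ hs hf
  obtain ⟨hsup, hdef⟩ := hC a
  set G := latticeSum a φ₀ with hG
  have hGc : Continuous G := by
    rw [hG]
    unfold latticeSum
    fun_prop
  have hnorm : ‖f‖ₑ ^ 2 = ‖latticeSumL2 a φ‖ₑ ^ 2 := by
    rw [enorm_sq_eq_lintegral, enorm_sq_eq_lintegral,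
      ← lintegral_scale hs fun x => ‖latticeSumL2 a φ x‖ₑ ^ 2]
    refine lintegral_congr_ae ?_
    have h1 : ∀ᵐ x : Rd d, latticeSumL2 a φ x = G x :=
      (coeFn_latticeSumL2 a φ).trans (latticeSum_congr_ae a hφφ₀)
    filter_upwards [ha, ae_comp_smul (inv_pos.2 hs).ne' h1] with x h2 h3
    rw [h2, h3, enorm_mul, mul_pow]
  refine ⟨fun x => scaleFactor d s * G (s⁻¹ • x), by fun_prop, ha, fun x => ?_, fun τ hτ => ?_⟩
  · rw [enorm_mul, mul_pow, hnorm]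
    gcongr
    exact hsup _
  let σ : Rd d → Rd d := fun z => s⁻¹ • τ (s • z)
  have hσ : ∀ᵐ z, ‖σ z‖ ≤ supNorm τ / s := by
    filter_upwards [ae_comp_smul hs.ne' (ae_norm_le_supNorm hτ)] with z hz
    rw [norm_smul, norm_inv, Real.norm_of_nonneg hs.le, inv_mul_eq_div]
    gcongr
  have h1 : ∫⁻ x, ‖deform τ (fun x => scaleFactor d s * G (s⁻¹ • x)) x -
      scaleFactor d s * G (s⁻¹ • x)‖ₑ ^ 2 = ∫⁻ z, ‖deform σ G z - G z‖ₑ ^ 2 := by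
    rw [← lintegral_scale hs fun z => ‖deform σ G z - G z‖ₑ ^ 2]
    refine lintegral_congr fun x => ?_
    rw [deform, deform, ← mul_sub, enorm_mul, mul_pow]
    simp only [σ, smul_inv_smul₀ hs.ne', smul_sub]
  rw [h1, hnorm]
  rcases le_total (supNorm τ / s) 1 with hr | hr
  · rw [deformRate_of_le_one hr]
    exact (hdef _ σ hσ).1 hr
  · rw [deformRate_of_one_le hr]
    exact (hdef _ σ hσ).2 hr

/-! ### Passage to the closed span -/

/-- The estimates on the approximation space. The representatives of an approximating sequence of
finite sums converge uniformly, and the bound passes to the limit by Fatou's lemma. -/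
theorem exists_approxSpace_deform_le {d : ℕ} {φ : L2 d} (hRiesz : RieszCondition φ)
    (hReg : RegularityCondition φ) (hDeriv : DerivRegularityCondition φ) :
    ∃ C : ℝ≥0, ∀ s : ℝ, 0 < s → ∀ f ∈ approxSpace φ s,
      ∃ g : Rd d → ℂ, Continuous g ∧ f =ᵐ[volume] g ∧
        ∀ τ : Rd d → Rd d, MemLp τ ∞ volume →
          ∫⁻ x, ‖deform τ g x - g x‖ₑ ^ 2 ≤ deformRate d (supNorm τ / s) * (C * ‖f‖ₑ ^ 2) := by
  obtain ⟨C, hC⟩ := exists_atomSpan_deform_le hRiesz hReg hDeriv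
  refine ⟨C, fun s hs f hf => ?_⟩
  obtain ⟨u, hu, hlim⟩ := mem_closure_iff_seq_limit.1
    (show f ∈ closure (atomSpan φ s : Set (L2 d)) from hf)
  choose g hgc hug hgsup hgdef using fun n => hC s hs (u n) (hu n)
  let K : ℝ := ‖scaleFactor d s‖ * Real.sqrt C
  have hK : 0 ≤ K := by positivity
  have hreal : ∀ (z : ℂ) (t : L2 d), ‖z‖ₑ ^ 2 ≤ ‖scaleFactor d s‖ₑ ^ 2 * (C * ‖t‖ₑ ^ 2) →
      ‖z‖ ≤ K * ‖t‖ := by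
    intro z t h
    have h1 := ENNReal.toReal_mono (ENNReal.mul_ne_top (ENNReal.pow_ne_top enorm_ne_top)
      (ENNReal.mul_ne_top ENNReal.coe_ne_top (ENNReal.pow_ne_top enorm_ne_top))) h
    simp only [ENNReal.toReal_pow, ENNReal.toReal_mul, toReal_enorm, ENNReal.coe_toReal] at h1
    refine le_of_sq_le_sq ?_ (by positivity)
    rw [mul_pow, mul_pow, Real.sq_sqrt C.coe_nonneg]
    linarith
  have hdiff : ∀ n m x, ‖g n x - g m x‖ ≤ K * ‖u n - u m‖ := by
    intro n m x
    obtain ⟨w, hwc, huw, hwsup, -⟩ := hC s hs (u n - u m) (Submodule.sub_mem _ (hu n) (hu m))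
    have h1 : w =ᵐ[volume] fun x => g n x - g m x := by
      filter_upwards [huw, Lp.coeFn_sub (u n) (u m), hug n, hug m] with y h1 h2 h3 h4
      rw [← h1, h2, Pi.sub_apply, h3, h4]
    have h2 : w = fun x => g n x - g m x :=
      (Continuous.ae_eq_iff_eq volume hwc ((hgc n).sub (hgc m))).1 h1
    have h3 := hreal _ _ (hwsup x)
    rwa [h2] at h3
  let b : ℕ → BoundedContinuousFunction (Rd d) ℂ := fun n =>
    BoundedContinuousFunction.ofNormedAddCommGroup (g n) (hgc n) (K * ‖u n‖)
      fun x => hreal _ _ (hgsup n x)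
  have hb : CauchySeq b := by
    rw [Metric.cauchySeq_iff]
    intro ε hε
    obtain ⟨N, hN⟩ := Metric.cauchySeq_iff.1 hlim.cauchySeq (ε / (K + 1)) (by positivity)
    refine ⟨N, fun m hm n hn => ?_⟩
    have h1 : dist (b m) (b n) ≤ K * ‖u m - u n‖ :=
      (BoundedContinuousFunction.dist_le (by positivity)).2 fun x => by
        rw [dist_eq_norm]
        exact hdiff m n x
    have h2 := hN m hm n hn
    rw [dist_eq_norm, lt_div_iff₀ (by positivity)] at h2
    nlinarith [norm_nonneg (u m - u n)]
  obtain ⟨g', hg'⟩ := cauchySeq_tendsto_of_complete hb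
  have hpt : ∀ x, Filter.Tendsto (fun n => g n x) Filter.atTop (nhds (g' x)) := fun x =>
    (BoundedContinuousFunction.tendsto_iff_tendstoUniformly.1 hg').tendsto_at x
  refine ⟨g', g'.continuous, ?_, fun τ hτ => ?_⟩
  · obtain ⟨ns, hns, hae⟩ := (tendstoInMeasure_of_tendsto_Lp hlim).exists_seq_tendsto_ae
    filter_upwards [hae, ae_all_iff.2 hug] with x h1 h2
    refine tendsto_nhds_unique h1 ?_
    simp only [h2]
    exact (hpt x).comp hns.tendsto_atTop
  · have hmeas : ∀ n, AEMeasurable (fun x => ‖deform τ (g n) x - g n x‖ₑ ^ 2) volume := by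
      intro n
      have h1 : AEStronglyMeasurable (deform τ (g n)) volume :=
        (hgc n).comp_aestronglyMeasurable (continuous_id.aestronglyMeasurable.sub hτ.1)
      exact (h1.sub (hgc n).aestronglyMeasurable).enorm.pow_const 2
    have hlim2 : ∀ x, Filter.Tendsto (fun n => ‖deform τ (g n) x - g n x‖ₑ ^ 2) Filter.atTop
        (nhds (‖deform τ g' x - g' x‖ₑ ^ 2)) := fun x =>
      ((ENNReal.continuous_pow 2).tendsto _).comp
        ((continuous_enorm.tendsto _).comp ((hpt (x - τ x)).sub (hpt x)))
    have hlim3 : Filter.Tendsto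
        (fun n => deformRate d (supNorm τ / s) * (C * ‖u n‖ₑ ^ 2)) Filter.atTop
        (nhds (deformRate d (supNorm τ / s) * (C * ‖f‖ₑ ^ 2))) := by
      refine ENNReal.Tendsto.const_mul (ENNReal.Tendsto.const_mul ?_ (Or.inr ENNReal.coe_ne_top))
        (Or.inr (deformRate_ne_top _ _))
      exact ((ENNReal.continuous_pow 2).tendsto _).comp ((continuous_enorm.tendsto f).comp hlim)
    calc ∫⁻ x, ‖deform τ g' x - g' x‖ₑ ^ 2
        = ∫⁻ x, Filter.liminf (fun n => ‖deform τ (g n) x - g n x‖ₑ ^ 2) Filter.atTop :=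
          lintegral_congr fun x => (hlim2 x).liminf_eq.symm
      _ ≤ Filter.liminf (fun n => ∫⁻ x, ‖deform τ (g n) x - g n x‖ₑ ^ 2) Filter.atTop :=
          lintegral_liminf_le' hmeas
      _ ≤ Filter.liminf (fun n => deformRate d (supNorm τ / s) * (C * ‖u n‖ₑ ^ 2))
            Filter.atTop :=
          Filter.liminf_le_liminf (Filter.Eventually.of_forall fun n => hgdef n τ hτ)
      _ = _ := hlim3.liminf_eq

theorem norm_sub_le_lipConst_mul {X Y : Type*} [SeminormedAddCommGroup X]
    [SeminormedAddCommGroup Y] {Φ : X → Y} (hΦ : ∃ K : ℝ≥0, LipschitzWith K Φ) (x y : X) :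
    ‖Φ x - Φ y‖ ≤ lipConst Φ * ‖x - y‖ := by
  rcases (norm_nonneg (x - y)).eq_or_lt with h0 | hpos
  · obtain ⟨K, hK⟩ := hΦ
    have := hK.norm_sub_le x y
    rw [← h0, mul_zero] at this ⊢
    exact this
  · rw [← div_le_iff₀ hpos]
    have h1 : (‖Φ x - Φ y‖ / ‖x - y‖).toNNReal ≤ lipConst Φ := by
      refine le_csInf hΦ fun K hK => ?_
      rw [Real.toNNReal_le_iff_le_coe, div_le_iff₀ hpos]
      exact hK.norm_sub_le x y
    exact Real.toNNReal_le_iff_le_coe.1 h1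

/-! ### The deformation estimate -/

theorem mainTheorem1 {d : ℕ} (hd : 1 ≤ d) (φ : L2 d)
    (hRiesz : RieszCondition φ) (hReg : RegularityCondition φ)
    (hDeriv : DerivRegularityCondition φ) :
    ∃ C : ℝ, 0 < C ∧ ∀ s : ℝ, 0 < s → ∀ f ∈ approxSpace φ s,
      -- `g` is the continuous representative of `f`, through which `F_τ f` is defined
      ∃ g : Rd d → ℂ, Continuous g ∧ (f : Rd d → ℂ) =ᵐ[volume] g ∧
        ∀ τ : Rd d → Rd d, MemLp τ ∞ volume →
          ∃ hF : MemLp (deform τ g) 2 volume,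
            (supNorm τ / s ≤ 1 →
              ‖hF.toLp (deform τ g) - f‖ ≤ C * (supNorm τ / s) * ‖f‖) ∧
            (1 ≤ supNorm τ / s →
              ‖hF.toLp (deform τ g) - f‖ ≤ C * (supNorm τ / s) ^ ((d : ℝ) / 2) * ‖f‖) ∧
            ∀ (Y : Type*) [NormedAddCommGroup Y] [NormedSpace ℝ Y] [CompleteSpace Y]
              (Φ : L2 d → Y), (∃ K : ℝ≥0, LipschitzWith K Φ) →
              (supNorm τ / s ≤ 1 →
                ‖Φ (hF.toLp (deform τ g)) - Φ f‖ ≤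
                  C * lipConst Φ * (supNorm τ / s) * ‖f‖) ∧
              (1 ≤ supNorm τ / s →
                ‖Φ (hF.toLp (deform τ g)) - Φ f‖ ≤
                  C * lipConst Φ * (supNorm τ / s) ^ ((d : ℝ) / 2) * ‖f‖) := by
  obtain ⟨C, hC⟩ := exists_approxSpace_deform_le hRiesz hReg hDeriv
  refine ⟨Real.sqrt C + 1, by positivity, fun s hs f hf => ?_⟩
  obtain ⟨g, hgc, hfg, hg⟩ := hC s hs f hf
  refine ⟨g, hgc, hfg, fun τ hτ => ?_⟩
  have hr : 0 ≤ supNorm τ / s := div_nonneg ENNReal.toReal_nonneg hs.le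
  have hle := hg τ hτ
  set r := supNorm τ / s with hrdef
  have hm : AEStronglyMeasurable (deform τ g) volume :=
    hgc.comp_aestronglyMeasurable (continuous_id.aestronglyMeasurable.sub hτ.1)
  have hfin : deformRate d r * (C * ‖f‖ₑ ^ 2) < ∞ :=
    ENNReal.mul_lt_top (deformRate_ne_top d r).lt_top
      (ENNReal.mul_lt_top ENNReal.coe_lt_top (ENNReal.pow_lt_top enorm_lt_top))
  have hF : MemLp (deform τ g) 2 volume := by
    have h1 : MemLp (fun x => deform τ g x - g x) 2 volume :=
      memLp_two_of_lintegral_lt_top (hm.sub hgc.aestronglyMeasurable) (hle.trans_lt hfin)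
    have h2 : MemLp g 2 volume := (Lp.memLp f).ae_eq hfg
    refine (h1.add h2).ae_eq (Filter.Eventually.of_forall fun x => ?_)
    simp
  have hsq : ‖hF.toLp (deform τ g) - f‖ ^ 2 ≤ (deformRate d r).toReal * (C * ‖f‖ ^ 2) := by
    have h1 : ‖hF.toLp (deform τ g) - f‖ₑ ^ 2 ≤ deformRate d r * (C * ‖f‖ₑ ^ 2) := by
      rw [enorm_sq_eq_lintegral]
      refine le_trans (le_of_eq (lintegral_congr_ae ?_)) hle
      filter_upwards [Lp.coeFn_sub (hF.toLp (deform τ g)) f, hF.coeFn_toLp, hfg] with x h1 h2 h3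
      rw [h1, Pi.sub_apply, h2, h3]
    have h2 := ENNReal.toReal_mono hfin.ne h1
    simpa only [ENNReal.toReal_pow, ENNReal.toReal_mul, toReal_enorm, ENNReal.coe_toReal] using h2
  -- Both regimes at once: `t` is the square root of the rate.
  have hmain : ∀ t : ℝ, 0 ≤ t → (deformRate d r).toReal = t ^ 2 →
      ‖hF.toLp (deform τ g) - f‖ ≤ (Real.sqrt C + 1) * t * ‖f‖ := by
    intro t ht hrate
    have h1 : ‖hF.toLp (deform τ g) - f‖ ≤ Real.sqrt C * t * ‖f‖ := by
      refine le_of_sq_le_sq (hsq.trans (le_of_eq ?_)) (by positivity)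
      rw [hrate, mul_pow, mul_pow, Real.sq_sqrt C.coe_nonneg]
      ring
    refine h1.trans ?_
    gcongr
    linarith
  have hsmall : r ≤ 1 → ‖hF.toLp (deform τ g) - f‖ ≤ (Real.sqrt C + 1) * r * ‖f‖ := by
    intro h
    refine hmain r hr ?_
    rw [deformRate_of_le_one h, ENNReal.toReal_pow, ENNReal.toReal_ofReal hr]
  have hlarge : 1 ≤ r →
      ‖hF.toLp (deform τ g) - f‖ ≤ (Real.sqrt C + 1) * r ^ ((d : ℝ) / 2) * ‖f‖ := by
    intro h
    refine hmain _ (Real.rpow_nonneg hr _) ?_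
    rw [deformRate_of_one_le h, ENNReal.toReal_pow, ENNReal.toReal_ofReal hr,
      ← Real.rpow_mul_natCast hr, ← Real.rpow_natCast]
    congr 1
    push_cast
    ring
  refine ⟨hF, hsmall, hlarge, fun Y _ _ _ Φ hΦ => ?_⟩
  have hlip := norm_sub_le_lipConst_mul hΦ (hF.toLp (deform τ g)) f
  have hL : (0 : ℝ) ≤ lipConst Φ := NNReal.coe_nonneg _
  refine ⟨fun h => hlip.trans ?_, fun h => hlip.trans ?_⟩
  · refine (mul_le_mul_of_nonneg_left (hsmall h) hL).trans (le_of_eq ?_)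
    ring
  · refine (mul_le_mul_of_nonneg_left (hlarge h) hL).trans (le_of_eq ?_)
    ring
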